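/- All graphs are finite and loopless; parallel edges are allowed. A cycle is a connected $2$-regular graph. A Kotzig graph is a cubic graph $K$ with a Kotzig-coloring, that is, a proper $3$-edge-coloring such that every cycle of $K$ whose edges have at most two colors is hamiltonian. A subdivision of $K$ is a graph $K'$ obtained from $K$ by replacing at least one edge $e=vw$ by a $vw$-path of length at least $2$; for every edge $e$ of $K$, replaced or not, let $e'$ be the corresponding path of $K'$. Let $G$ be a cubic graph. A Kotzig-frame of $G$ is a spanning subgraph $F$ of $G$ such that every component of $F$ has an even number of vertices and is either a cycle (a C-component) or a subdivision of a Kotzig graph (a K-component). Let $G_F$ be the graph obtained from $G$ by contracting every component of $F$ to a distinct vertex and deleting all loops that arise; the K-vertices of $G_F$ are those that correspond to K-components. A perfect coloring $\alpha$ of $F$ is a (not necessarily proper) coloring of the vertices and of the edges of $F$ with the colors $1,2,3$ such that in each C-component all vertices and edges have the same color, and each K-component $K'$ is a subdivision of a Kotzig graph $K$ such that (i) any two edges of $K'$ incident with the same $2$-valent vertex of $K'$ have the same color, (ii) each $2$-valent vertex of $K'$ has the same color as its incident edges in $K'$, and (iii) giving every edge $e$ of $K$ the color of the edges of $e'$ yields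 a Kotzig-coloring of $K$. Given $\alpha$, color an edge of $G_F$ that corresponds to an edge $vw$ of $G$ with the color $\alpha(v)$ if $\alpha(v)=\alpha(w)$, and leave it uncolored otherwise. The Kotzig-frame $F$ is well connected if, for some perfect coloring $\alpha$ of $F$, the graph $G_F$ has a connected subgraph $H$ that contains all K-vertices and all of whose edges are colored with one and the same color. Theorem. If a cubic graph $G$ has a well connected Kotzig-frame, then $G$ has a $6$-cycle double cover: there is a set $S$ of cycles of $G$ such that every edge of $G$ is contained in precisely two cycles of $S$, and $S$ can be partitioned into $6$ (possibly empty) subsets each of which consists of pairwise edge-disjoint cycles. -/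

import Mathlib

open scoped Graph

universe u v u' v'

namespace CDC

/-! Graphs are multigraphs (Mathlib's `Graph α β`: vertices in `α`, edge names in `β`, parallel edges
and loops allowed); `H ≤ G` means that `H` is a subgraph of `G`. -/

section Basic

variable {α : Type u} {β : Type v}

/-- `G` has finitely many vertices and edges. -/
def IsFinite (G : Graph α β) : Prop := V(G).Finite ∧ E(G).Finite

/-- The degree of a vertex: the number of incident edges, loops being counted twice. -/
noncomputable def degree (G : Graph α β) (x : α) : ℕ∞ :=
  (G.incidenceSet x).encard + (G.loopSet x).encard

/-- Every vertex has degree `3`. -/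
def IsCubic (G : Graph α β) : Prop := ∀ x ∈ V(G), degree G x = 3

/-- `G` is nonempty and any two vertices are joined by a walk. -/
def Connected (G : Graph α β) : Prop :=
  V(G).Nonempty ∧ ∀ x ∈ V(G), ∀ y ∈ V(G), Relation.ReflTransGen G.Adj x y

/-- A cycle is a finite connected `2`-regular graph (so two parallel edges form a cycle). -/
structure IsCycle (C : Graph α β) : Prop where
  finite : IsFinite C
  connected : Connected C
  degree_eq : ∀ x ∈ V(C), degree C x = 2

/-- The connected component of `F` containing the vertex `x`. -/
def componentAt (F : Graph α β) (x : α) : Graph α β :=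
  F.induce {y | y ∈ V(F) ∧ Relation.ReflTransGen F.Adj x y}

/-- `L` is a connected component of `F`. -/
def IsComponent (F L : Graph α β) : Prop := ∃ x ∈ V(F), L = componentAt F x

/-- `P` is a path with endvertices `a` and `b`: it consists of distinct vertices
`p 0 = a, p 1, …, p n = b` and edges `q i` joining `p i` to `p (i + 1)` for `i < n`. -/
def IsPathBetween (P : Graph α β) (a b : α) : Prop :=
  ∃ (n : ℕ) (p : ℕ → α) (q : ℕ → β),
    p 0 = a ∧ p n = b ∧ Set.InjOn p (Set.Iic n) ∧
    V(P) = p '' Set.Iic n ∧ E(P) = q '' Set.Iio n ∧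
    ∀ i < n, P.IsLink (q i) (p i) (p (i + 1))

end Basic

section DoubleCover

variable {α : Type u} {β : Type v}

/-- `S` is a cycle double cover of `G`: a set of cycles of `G` such that every edge of `G` lies in
precisely two of them. -/
def IsCycleDoubleCover (G : Graph α β) (S : Set (Graph α β)) : Prop :=
  (∀ C ∈ S, C ≤ G ∧ IsCycle C) ∧ ∀ e ∈ E(G), {C ∈ S | e ∈ E(C)}.encard = 2

/-- `G` has a `k`-cycle double cover: a cycle double cover `S` that can be partitioned into `k`
(possibly empty) subsets each of which consists of pairwise edge-disjoint cycles. -/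
def HasCycleDoubleCover (k : ℕ) (G : Graph α β) : Prop :=
  ∃ S : Set (Graph α β), IsCycleDoubleCover G S ∧
    ∃ P : Fin k → Set (Graph α β),
      (⋃ i, P i) = S ∧
      (∀ i j, i ≠ j → Disjoint (P i) (P j)) ∧
      ∀ i, ∀ C ∈ P i, ∀ D ∈ P i, C ≠ D → Disjoint E(C) E(D)

end DoubleCover

section KotzigGraph

variable {α : Type u} {β : Type v}

/-- The `3`-edge-coloring `c` of `K` is proper: distinct edges with a common end have distinct
colors. -/
def IsProperEdgeColoring (K : Graph α β) (c : β → Fin 3) : Prop :=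
  ∀ x e f, K.Inc e x → K.Inc f x → e ≠ f → c e ≠ c f

/-- A Kotzig-coloring: a proper `3`-edge-coloring such that every bicolored cycle (a cycle of `K`
whose edges have at most two colors) is hamiltonian. -/
def IsKotzigColoring (K : Graph α β) (c : β → Fin 3) : Prop :=
  IsProperEdgeColoring K c ∧
    ∀ C : Graph α β, C ≤ K → IsCycle C → (∃ a b : Fin 3, ∀ e ∈ E(C), c e = a ∨ c e = b) →
      V(C) = V(K)

/-- A Kotzig graph: a finite loopless cubic graph with a Kotzig-coloring. -/
structure IsKotzigGraph (K : Graph α β) : Prop where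
  finite : IsFinite K
  loopless : K.Loopless
  cubic : IsCubic K
  exists_coloring : ∃ c : β → Fin 3, IsKotzigColoring K c

end KotzigGraph

section Subdivision

variable {α : Type u} {β : Type v} {α' : Type u'} {β' : Type v'}

/-- A presentation of `K'` as a subdivision of the loopless graph `K`: `K'` arises from (a copy of)
`K` by replacing every edge `e = xy` by a path `path e` between the copies of `x` and `y`, at least
one of these paths having length at least `2` (a path of length `1` means that the edge is not
replaced). -/
structure Subdivision (K : Graph α' β') (K' : Graph α β) where
  /-- the vertex of `K'` corresponding to a vertex of `K` -/
  branch : α' → α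
  /-- the path of `K'` corresponding to an edge of `K` -/
  path : β' → Graph α β
  branch_injOn : Set.InjOn branch V(K)
  path_le : ∀ e ∈ E(K), path e ≤ K'
  isPath : ∀ e x y, K.IsLink e x y → IsPathBetween (path e) (branch x) (branch y)
  /-- a path contains no copies of vertices of `K` except for its ends -/
  inc_of_branch_mem : ∀ e ∈ E(K), ∀ z ∈ V(K), branch z ∈ V(path e) → K.Inc e z
  /-- paths of distinct edges have no common inner vertices -/
  inter_subset : ∀ e ∈ E(K), ∀ f ∈ E(K), e ≠ f → V(path e) ∩ V(path f) ⊆ branch '' V(K)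
  edge_disjoint : ∀ e ∈ E(K), ∀ f ∈ E(K), e ≠ f → Disjoint E(path e) E(path f)
  vertexSet_eq : V(K') = branch '' V(K) ∪ ⋃ e ∈ E(K), V(path e)
  edgeSet_eq : E(K') = ⋃ e ∈ E(K), E(path e)
  proper : ∃ e ∈ E(K), 2 ≤ E(path e).encard

end Subdivision

section Frame

variable {α : Type u} {β : Type v}

/-- `L` is a subdivision of a Kotzig graph. -/
def IsSubdividedKotzigGraph (L : Graph α β) : Prop :=
  ∃ (α' : Type u) (β' : Type v) (K : Graph α' β'), IsKotzigGraph K ∧ Nonempty (Subdivision K L)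

/-- `F` is a Kotzig-frame of `G`. -/
structure IsKotzigFrame (G F : Graph α β) : Prop where
  spanning : F ≤s G
  even_card : ∀ L, IsComponent F L → Even V(L).ncard
  cycle_or_subdivision : ∀ L, IsComponent F L → IsCycle L ∨ IsSubdividedKotzigGraph L

/-- A component of `F` is a C-component if it is a cycle. -/
def IsCComponent (F L : Graph α β) : Prop := IsComponent F L ∧ IsCycle L

/-- A component of `F` is a K-component if it is not a cycle. -/
def IsKComponent (F L : Graph α β) : Prop := IsComponent F L ∧ ¬ IsCycle L

/-- The graph `G_F`: every component of the spanning subgraph `F` of `G` is contracted to a distinct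
vertex (this vertex is the component itself), and all loops which arise are deleted. -/
def contraction (G F : Graph α β) : Graph (Graph α β) β :=
  (G.map (componentAt F)).deleteEdges {e | ∃ L, (G.map (componentAt F)).IsLoopAt e L}

/-- A `3`-vertex-coloring together with a `3`-edge-coloring, neither necessarily proper. -/
structure TotalColoring (α : Type u) (β : Type v) where
  vertexColor : α → Fin 3
  edgeColor : β → Fin 3

/-- `φ` is a perfect coloring of `K'`, a subdivision of some Kotzig graph `K`: any two edges incident
with the same `2`-valent vertex have the same color, this is also the color of the vertex, and the
implied edge-coloring of `K` is a Kotzig-coloring. -/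
def IsPerfectOnSubdivision (K' : Graph α β) (φ : TotalColoring α β) : Prop :=
  ∃ (α' : Type u) (β' : Type v) (K : Graph α' β') (s : Subdivision K K'),
    IsKotzigGraph K ∧
    (∀ x ∈ V(K'), degree K' x = 2 →
      ∀ e f, K'.Inc e x → K'.Inc f x → φ.edgeColor e = φ.edgeColor f) ∧
    (∀ x ∈ V(K'), degree K' x = 2 → ∀ e, K'.Inc e x → φ.vertexColor x = φ.edgeColor e) ∧
    ∃ c : β' → Fin 3,
      (∀ e ∈ E(K), ∀ f ∈ E(s.path e), c e = φ.edgeColor f) ∧ IsKotzigColoring K c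

/-- `φ` is a perfect coloring of the Kotzig-frame `F`: it is perfect on every K-component, and on
every C-component all vertices and edges have the same color. -/
def IsPerfectColoring (F : Graph α β) (φ : TotalColoring α β) : Prop :=
  (∀ L, IsKComponent F L → IsPerfectOnSubdivision L φ) ∧
    ∀ L, IsCComponent F L →
      ∃ a : Fin 3, (∀ x ∈ V(L), φ.vertexColor x = a) ∧ ∀ e ∈ E(L), φ.edgeColor e = a

/-- In the partial edge-coloring of `G_F` induced by `φ`, the edge `e` of `G_F` has color `a`:
both ends of `e` in `G` have vertex color `a`. -/
def HasColor (G F : Graph α β) (φ : TotalColoring α β) (e : β) (a : Fin 3) : Prop :=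
  e ∈ E(contraction G F) ∧
    ∃ x y, G.IsLink e x y ∧ φ.vertexColor x = a ∧ φ.vertexColor y = a

/-- The Kotzig-frame `F` of `G` is well connected: for some perfect coloring of `F`, the partially
edge-colored graph `G_F` has a connected subgraph `H` which contains all K-vertices and whose edges
are all colored with the same color. -/
def IsWellConnected (G F : Graph α β) : Prop :=
  ∃ φ : TotalColoring α β, IsPerfectColoring F φ ∧
    ∃ H : Graph (Graph α β) β, H ≤ contraction G F ∧ Connected H ∧
      (∀ L, IsKComponent F L → L ∈ V(H)) ∧
      ∃ a : Fin 3, ∀ e ∈ E(H), HasColor G F φ e a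

end Frame

end CDC

/-! Everything is done mod 2. In a cubic graph a set of edges with even degree at every vertex is a
disjoint union of cycles, so six even sets covering every edge exactly twice suffice
(`hasCycleDoubleCover_of_even`).

The six sets form three pairs, one for each color k. Suppose that the edges outside the frame F are
partitioned into classes M_k, each even in G_F, such that no edge of M_k has an end of color k.
Inside a component of F the edges of color other than k form an even graph D_k that connects the
ends of M_k there; in a K-component this holds because two colors of a Kotzig-coloring form a
hamiltonian cycle. A T-join J_k inside D_k makes J_k + M_k even. The sets J_k + M_k and D_k + J_k +
M_k both contain M_k and share out D_k between them, and a frame edge lies in D_k for exactly two k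
(`exists_double_cover_of_distribution`).

To find the classes, let a be the color of H and b, c the others. Components outside H are cycles
and are given the color b; then b and c may be exchanged on each component separately. By
`exists_even_cut`, suitable exchanges give equal colors to the ends of every outside edge that
avoids a, except for edges in a set Z that is even in G_F. Put M_a = Z and split the rest into
classes for b and c. These two have the same boundary in G_F, since the outside edges form an even
set there. At a component outside H one of the two classes has no edge, so the boundary lives on H;
as H is connected and its edges fit both classes, switching a T-join of H between them makes both
even (`exists_distribution`). -/

namespace CDC

/-! ### Mod 2 boundaries, T-joins and cuts. -/

section Boundary

variable {V E Q : Type*} [Fintype E]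

open Classical in
/-- The indicator of a proposition, with values in `ZMod 2`. -/
noncomputable def indic (p : Prop) : ZMod 2 := if p then 1 else 0

theorem indic_pos {p : Prop} (h : p) : indic p = 1 := if_pos h

theorem indic_neg {p : Prop} (h : ¬ p) : indic p = 0 := if_neg h

theorem indic_ne_zero {p : Prop} : indic p ≠ 0 ↔ p := by
  by_cases h : p <;> simp [indic, h]

theorem add_self_zmod2 (x : ZMod 2) : x + x = 0 := CharTwo.add_self_eq_zero x

theorem eq_one_of_ne_zero : ∀ {x : ZMod 2}, x ≠ 0 → x = 1 := by decide

/-- The mod `2` boundary of a set of edges, the edge `e` having the ends `s e` and `t e`. -/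
noncomputable def boundary (s t : E → V) (J : E → ZMod 2) (v : V) : ZMod 2 :=
  ∑ e, J e * (indic (s e = v) + indic (t e = v))

/-- `x` and `y` are joined by an edge in `D`. -/
def Joins (s t : E → V) (D : E → Prop) (x y : V) : Prop :=
  ∃ e, D e ∧ ((s e = x ∧ t e = y) ∨ (s e = y ∧ t e = x))

theorem boundary_add (s t : E → V) (J K : E → ZMod 2) :
    boundary s t (J + K) = boundary s t J + boundary s t K := by
  funext v
  simp [boundary, add_mul, Finset.sum_add_distrib]

theorem boundary_zero (s t : E → V) : boundary s t 0 = 0 := by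
  funext v
  simp [boundary]

theorem boundary_smul (s t : E → V) (a : ZMod 2) (J : E → ZMod 2) :
    boundary s t (a • J) = a • boundary s t J := by
  funext v
  simp [boundary, Finset.mul_sum, mul_assoc]

theorem boundary_sum {ι : Type*} (s t : E → V) (I : Finset ι) (J : ι → E → ZMod 2) :
    boundary s t (∑ i ∈ I, J i) = ∑ i ∈ I, boundary s t (J i) := by
  classical
  induction I using Finset.induction_on with
  | empty => simp [boundary_zero]
  | insert i I hi ih => rw [Finset.sum_insert hi, Finset.sum_insert hi, boundary_add, ih]

theorem boundary_single [DecidableEq E] (s t : E → V) (e : E) (v : V) :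
    boundary s t (Pi.single e 1) v = indic (s e = v) + indic (t e = v) := by
  simp [boundary, Pi.single_apply]

theorem sum_indic_eq [Fintype V] (x : V) (f : V → ZMod 2) : ∑ v, indic (x = v) * f v = f x := by
  classical
  rw [Finset.sum_eq_single x]
  · simp [indic]
  · intro b _ hb
    simp [indic, hb.symm]
  · simp

theorem sum_boundary [Fintype V] (s t : E → V) (J : E → ZMod 2) : ∑ v, boundary s t J v = 0 := by
  unfold boundary
  rw [Finset.sum_comm]
  refine Finset.sum_eq_zero fun e _ ↦ ?_
  have h (x : V) : ∑ v, indic (x = v) = 1 := by simpa using sum_indic_eq x (fun _ ↦ 1)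
  rw [← Finset.mul_sum, Finset.sum_add_distrib, h, h, add_self_zmod2, mul_zero]

/-- Edges inside a fiber become loops and cancel. Hence evenness after contraction is exactly the
parity condition for a T-join inside each component. -/
theorem boundary_comp [Fintype V] (s t : E → V) (κ : V → Q) (J : E → ZMod 2) (q : Q) :
    boundary (κ ∘ s) (κ ∘ t) J q = ∑ v, indic (κ v = q) * boundary s t J v := by
  unfold boundary
  simp_rw [Finset.mul_sum]
  rw [Finset.sum_comm]
  refine Finset.sum_congr rfl fun e _ ↦ ?_
  have h : ∀ v, indic (κ v = q) * (J e * (indic (s e = v) + indic (t e = v))) =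
      J e * (indic (s e = v) * indic (κ v = q) + indic (t e = v) * indic (κ v = q)) := by
    intro v; ring
  simp_rw [h]
  rw [← Finset.mul_sum, Finset.sum_add_distrib,
    sum_indic_eq (s e) (fun v ↦ indic (κ v = q)), sum_indic_eq (t e) (fun v ↦ indic (κ v = q))]
  rfl

/-- The mod 2 sum of the edges of a walk telescopes; repeated edges cancel, so no path has to be
extracted. -/
theorem exists_boundary_of_reach (s t : E → V) (D : E → Prop) {x y : V}
    (h : Relation.ReflTransGen (Joins s t D) x y) :
    ∃ J : E → ZMod 2, (∀ e, ¬ D e → J e = 0) ∧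
      ∀ v, boundary s t J v = indic (x = v) + indic (y = v) := by
  classical
  induction h with
  | refl => exact ⟨0, by simp, fun v ↦ by rw [boundary_zero, add_self_zmod2]; rfl⟩
  | @tail y z _ hyz ih =>
    obtain ⟨J, hJ, hb⟩ := ih
    obtain ⟨e, he, hends⟩ := hyz
    refine ⟨J + Pi.single e 1, fun f hf ↦ ?_, fun v ↦ ?_⟩
    · have : f ≠ e := by rintro rfl; exact hf he
      simp [hJ f hf, this]
    · rw [boundary_add, Pi.add_apply, hb, boundary_single]
      have h2 := add_self_zmod2 (indic (y = v))
      rcases hends with ⟨rfl, rfl⟩ | ⟨rfl, rfl⟩ <;> linear_combination h2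

/-- Add up walks from a root `r` in T to all vertices of T: the root is counted |T| times, which is
even. Only the vertices of `U` need to be connected by `D`. -/
theorem exists_tjoin [Fintype V] (s t : E → V) (D : E → Prop) (U : V → Prop)
    (hU : ∀ x y, U x → U y → Relation.ReflTransGen (Joins s t D) x y) (T : V → ZMod 2)
    (hT : ∀ v, T v ≠ 0 → U v) (hsum : ∑ v, T v = 0) :
    ∃ J : E → ZMod 2, (∀ e, ¬ D e → J e = 0) ∧ boundary s t J = T := by
  classical
  by_cases h0 : T = 0
  · exact ⟨0, by simp, by rw [boundary_zero, h0]⟩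
  obtain ⟨r, hr⟩ : ∃ r, T r ≠ 0 := by
    by_contra h
    push Not at h
    exact h0 (funext h)
  have key : ∀ v, ∃ J : E → ZMod 2, T v ≠ 0 → (∀ e, ¬ D e → J e = 0) ∧
      ∀ w, boundary s t J w = indic (r = w) + indic (v = w) := by
    intro v
    by_cases hv : T v = 0
    · exact ⟨0, fun h ↦ absurd hv h⟩
    · obtain ⟨J, hJ⟩ := exists_boundary_of_reach s t D (hU r v (hT r hr) (hT v hv))
      exact ⟨J, fun _ ↦ hJ⟩
  choose J hJ using key
  refine ⟨∑ v, T v • J v, fun e he ↦ ?_, ?_⟩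
  · rw [Finset.sum_apply]
    refine Finset.sum_eq_zero fun v _ ↦ ?_
    by_cases hv : T v = 0
    · simp [hv]
    · simp [(hJ v hv).1 e he]
  · rw [boundary_sum]
    funext w
    rw [Finset.sum_apply]
    have h1 : ∀ v, boundary s t (T v • J v) w = T v * indic (r = w) + T v * indic (v = w) := by
      intro v
      rw [boundary_smul, Pi.smul_apply, smul_eq_mul]
      by_cases hv : T v = 0
      · simp [hv]
      · rw [(hJ v hv).2, mul_add]
    simp_rw [h1]
    rw [Finset.sum_add_distrib, ← Finset.sum_mul, hsum, zero_mul, zero_add,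
      Finset.sum_eq_single w]
    · simp [indic]
    · intro b _ hb
      simp [indic, hb]
    · simp

/-- Outside a suitable even subset `Z` of `N`, any set `R` of edges of `N` is a cut. -/
theorem exists_even_cut (s t : E → V) (N : Finset E) (R : E → ZMod 2) :
    ∃ (X : V → ZMod 2) (Z : E → ZMod 2), (∀ e ∉ N, Z e = 0) ∧ boundary s t Z = 0 ∧
      ∀ e ∈ N, Z e = 0 → R e = X (s e) + X (t e) := by
  classical
  induction N using Finset.induction_on with
  | empty => exact ⟨0, 0, by simp, boundary_zero s t, by simp⟩
  | insert e N heN ih =>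
    obtain ⟨X, Z, hZN, hZ, hX⟩ := ih
    by_cases hR : R e = X (s e) + X (t e)
    · refine ⟨X, Z, fun f hf ↦ hZN f fun h ↦ hf (Finset.mem_insert_of_mem h), hZ, fun f hf h0 ↦ ?_⟩
      rcases Finset.mem_insert.1 hf with rfl | hf
      · exact hR
      · exact hX f hf h0
    -- If `e` closes a cycle with edges outside `Z`, that cycle is added to `Z`, which frees `e`
    -- from its equation. Otherwise `X` is flipped on everything reachable from `s e`, which changes
    -- the equation at `e` only.
    by_cases hc : Relation.ReflTransGen (Joins s t fun f ↦ f ∈ N ∧ Z f = 0) (s e) (t e)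
    · obtain ⟨J, hJ, hbJ⟩ := exists_boundary_of_reach _ _ _ hc
      refine ⟨X, Z + J + Pi.single e 1, fun f hf ↦ ?_, ?_, fun f hf h0 ↦ ?_⟩
      · rw [Finset.mem_insert, not_or] at hf
        simp [hZN f hf.2, hJ f (fun h ↦ hf.2 h.1), hf.1]
      · funext v
        rw [boundary_add, boundary_add, hZ, Pi.add_apply, Pi.add_apply, hbJ, boundary_single,
          Pi.zero_apply, zero_add, add_self_zmod2]
      · by_cases hfe : f = e
        · subst hfe
          simp [hZN f heN, hJ f (fun h ↦ heN h.1)] at h0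
        · have hfN : f ∈ N := Finset.mem_of_mem_insert_of_ne hf hfe
          refine hX f hfN ?_
          by_contra hne
          apply hne
          simpa [hfe, hJ f (fun h ↦ hne h.2)] using h0
    · refine ⟨fun v ↦ X v + indic (Relation.ReflTransGen
        (Joins s t fun f ↦ f ∈ N ∧ Z f = 0) (s e) v), Z,
        fun f hf ↦ hZN f fun h ↦ hf (Finset.mem_insert_of_mem h), hZ, fun f hf h0 ↦ ?_⟩
      rcases Finset.mem_insert.1 hf with rfl | hf
      · dsimp only
        rw [indic_pos .refl, indic_neg hc]
        revert hR
        generalize R f = r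
        generalize X (s f) = x
        generalize X (t f) = y
        revert r x y
        decide
      · have hiff : Relation.ReflTransGen (Joins s t fun f ↦ f ∈ N ∧ Z f = 0) (s e) (s f) ↔
            Relation.ReflTransGen (Joins s t fun f ↦ f ∈ N ∧ Z f = 0) (s e) (t f) :=
          ⟨fun h ↦ h.tail ⟨f, ⟨hf, h0⟩, .inl ⟨rfl, rfl⟩⟩,
            fun h ↦ h.tail ⟨f, ⟨hf, h0⟩, .inr ⟨rfl, rfl⟩⟩⟩
        dsimp only
        rw [hX f hf h0, hiff]
        linear_combination - add_self_zmod2 (indic (Relation.ReflTransGen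
          (Joins s t fun f ↦ f ∈ N ∧ Z f = 0) (s e) (t f)))

end Boundary

/-! ### Six even sets from a coloring of the frame. -/

section Core

variable {V E Q : Type*} [Fintype E]

/-- The edges of the frame in the component `q` with a color different from `k`. -/
def colorPart (s : E → V) (κ : V → Q) (inF : E → Prop) (ecol : E → Fin 3) (q : Q) (k : Fin 3)
    (e : E) : Prop :=
  inF e ∧ κ (s e) = q ∧ ecol e ≠ k

/-- In the component `q`, any two colors induce an even subgraph which connects all those
vertices outside which have one of these colors and an end of an edge outside the frame. -/
def GoodAt (s t : E → V) (κ : V → Q) (inF : E → Prop) (col : V → Fin 3) (ecol : E → Fin 3)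
    (q : Q) : Prop :=
  ∀ k, boundary s t (fun e ↦ indic (colorPart s κ inF ecol q k e)) = 0 ∧
    ∀ x y, κ x = q → κ y = q → col x ≠ k → col y ≠ k →
      (∃ e, ¬ inF e ∧ (s e = x ∨ t e = x)) → (∃ e, ¬ inF e ∧ (s e = y ∨ t e = y)) →
      Relation.ReflTransGen (Joins s t (colorPart s κ inF ecol q k)) x y

/-- A permutation of the colors merely permutes the three conditions. Only colors at `q` matter, so
different components can be recolored independently. -/
theorem GoodAt.congr {s t : E → V} {κ : V → Q} {inF : E → Prop} {col col' : V → Fin 3}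
    {ecol ecol' : E → Fin 3} {q : Q} (h : GoodAt s t κ inF col ecol q)
    (π : Equiv.Perm (Fin 3)) (hv : ∀ v, κ v = q → col' v = π (col v))
    (he : ∀ e, κ (s e) = q → ecol' e = π (ecol e)) : GoodAt s t κ inF col' ecol' q := by
  intro k
  have hcp : colorPart s κ inF ecol' q k = colorPart s κ inF ecol q (π.symm k) := by
    funext e
    unfold colorPart
    refine propext (and_congr_right fun _ ↦ and_congr_right fun hq ↦ ?_)
    rw [he e hq, Ne, Ne, Equiv.eq_symm_apply]
  rw [hcp]
  refine ⟨(h _).1, fun x y hx hy hxk hyk ↦ (h _).2 x y hx hy ?_ ?_⟩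
  · rwa [hv x hx, Ne, ← Equiv.eq_symm_apply] at hxk
  · rwa [hv y hy, Ne, ← Equiv.eq_symm_apply] at hyk

/-- The two-colored part is the whole component, or it is empty and there is no vertex left to
connect. So the color of a cycle can be chosen freely. -/
theorem goodAt_const {s t : E → V} {κ : V → Q} {inF : E → Prop} {col : V → Fin 3}
    {ecol : E → Fin 3} {q : Q} (p : Fin 3)
    (hb : boundary s t (fun e ↦ indic (inF e ∧ κ (s e) = q)) = 0)
    (hc : ∀ x y, κ x = q → κ y = q →
      Relation.ReflTransGen (Joins s t (fun e ↦ inF e ∧ κ (s e) = q)) x y)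
    (hv : ∀ v, κ v = q → col v = p) (he : ∀ e, κ (s e) = q → ecol e = p) :
    GoodAt s t κ inF col ecol q := by
  intro k
  by_cases hk : p = k
  · constructor
    · rw [← boundary_zero s t]
      congr 1
      funext e
      refine indic_neg fun h ↦ h.2.2 ?_
      rw [he e h.2.1, hk]
    · intro x y hx _ hxk
      exact absurd ((hv x hx).trans hk) hxk
  · have hcp : colorPart s κ inF ecol q k = fun e ↦ inF e ∧ κ (s e) = q := by
      funext e
      refine propext ⟨fun h ↦ ⟨h.1, h.2.1⟩, fun h ↦ ⟨h.1, h.2, ?_⟩⟩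
      rwa [he e h.2]
    rw [hcp]
    exact ⟨hb, fun x y hx hy _ _ _ _ ↦ hc x y hx hy⟩

theorem exists_ne_of_boundary_ne_zero {s t : E → V} {J : E → ZMod 2} {v : V}
    (h : boundary s t J v ≠ 0) : ∃ e, J e ≠ 0 ∧ (s e = v ∨ t e = v) := by
  by_contra hn
  push Not at hn
  refine h (Finset.sum_eq_zero fun e _ ↦ ?_)
  by_cases he : J e = 0
  · rw [he, zero_mul]
  · rw [indic_neg (hn e he).1, indic_neg (hn e he).2, add_zero, mul_zero]

theorem sum_fiber_indic [Fintype Q] (P : Prop) (x : Q) :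
    ∑ q, indic (P ∧ x = q) = indic P := by
  by_cases hP : P
  · simpa [hP, indic_pos] using sum_indic_eq x (fun _ ↦ 1)
  · simp [hP, indic]

/-- A double cover by six even sets from a distribution of the edges outside the frame over the
three pairs of colors. -/
theorem exists_double_cover_of_distribution [Fintype V] [Fintype Q] {s t : E → V} {κ : V → Q}
    {inF : E → Prop}
    {col : V → Fin 3} {ecol : E → Fin 3} (good : ∀ q, GoodAt s t κ inF col ecol q)
    (M : Fin 3 → E → ZMod 2) (hMF : ∀ k e, inF e → M k e = 0)
    (hM : ∀ e, ¬ inF e → ∃ k₀, ∀ k, M k e ≠ 0 ↔ k = k₀)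
    (hMcol : ∀ k e, M k e ≠ 0 → col (s e) ≠ k ∧ col (t e) ≠ k)
    (hMb : ∀ k, boundary (κ ∘ s) (κ ∘ t) (M k) = 0) :
    ∃ A : Fin 3 ⊕ Fin 3 → E → ZMod 2, (∀ i, boundary s t (A i) = 0) ∧
      ∀ e, ∃ i j, i ≠ j ∧ ∀ l, A l e ≠ 0 ↔ l = i ∨ l = j := by
  have key : ∀ k q, ∃ J : E → ZMod 2, (∀ e, ¬ colorPart s κ inF ecol q k e → J e = 0) ∧
      boundary s t J = fun v ↦ indic (κ v = q) * boundary s t (M k) v := by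
    intro k q
    refine exists_tjoin s t _ (fun v ↦ κ v = q ∧ col v ≠ k ∧ ∃ e, ¬ inF e ∧ (s e = v ∨ t e = v))
      (fun x y hx hy ↦ (good q k).2 x y hx.1 hy.1 hx.2.1 hy.2.1 hx.2.2 hy.2.2) _ (fun v hv ↦ ?_) ?_
    · have h1 : κ v = q := indic_ne_zero.1 (left_ne_zero_of_mul hv)
      obtain ⟨e, he, hev⟩ := exists_ne_of_boundary_ne_zero (right_ne_zero_of_mul hv)
      refine ⟨h1, ?_, e, fun h ↦ he (hMF k e h), hev⟩
      rcases hev with rfl | rfl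
      exacts [(hMcol k e he).1, (hMcol k e he).2]
    -- The prescribed boundary sums over the component to the boundary of `M k` at the contracted
    -- vertex `q`, which vanishes.
    · rw [← boundary_comp, hMb]
      rfl
  choose J hJ hJb using key
  set JJ : Fin 3 → E → ZMod 2 := fun k ↦ ∑ q, J k q with hJJ
  have hJJ0 : ∀ k e, ¬ (inF e ∧ ecol e ≠ k) → JJ k e = 0 := by
    intro k e he
    change (∑ q, J k q) e = 0
    rw [Finset.sum_apply]
    exact Finset.sum_eq_zero fun q _ ↦ hJ k q e fun h ↦ he ⟨h.1, h.2.2⟩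
  have hJJb : ∀ k, boundary s t (JJ k) = boundary s t (M k) := by
    intro k
    funext v
    change boundary s t (∑ q, J k q) v = _
    rw [boundary_sum, Finset.sum_apply]
    simp_rw [hJb]
    rw [← Finset.sum_mul]
    have := sum_indic_eq (κ v) (fun _ ↦ 1)
    simp only [mul_one] at this
    rw [this, one_mul]
  have hD : ∀ k, boundary s t (fun e ↦ indic (inF e ∧ ecol e ≠ k)) = 0 := by
    intro k
    have h : (fun e ↦ indic (inF e ∧ ecol e ≠ k)) =
        ∑ q, fun e ↦ indic (colorPart s κ inF ecol q k e) := by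
      funext e
      rw [Finset.sum_apply, ← sum_fiber_indic (inF e ∧ ecol e ≠ k) (κ (s e))]
      refine Finset.sum_congr rfl fun q _ ↦ ?_
      congr 1
      unfold colorPart
      exact propext (by tauto)
    rw [h, boundary_sum]
    exact Finset.sum_eq_zero fun q _ ↦ (good q k).1
  have hJM : ∀ k, boundary s t (JJ k + M k) = 0 := by
    intro k
    funext v
    rw [boundary_add, hJJb]
    exact add_self_zmod2 _
  refine ⟨Sum.elim (fun k ↦ JJ k + M k)
    (fun k ↦ (fun e ↦ indic (inF e ∧ ecol e ≠ k)) + (JJ k + M k)), ?_, fun e ↦ ?_⟩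
  · rintro (k | k)
    · exact hJM k
    · simp only [Sum.elim_inr]
      rw [boundary_add, hJM, hD, add_zero]
  · by_cases he : inF e
    -- For `k₁` and `k₂` the edge lies in exactly one set of the pair, chosen by `JJ`; for its own
    -- color it lies in neither.
    · obtain ⟨k₁, k₂, h12, h1, h2, h3⟩ : ∃ k₁ k₂, k₁ ≠ k₂ ∧ ecol e ≠ k₁ ∧ ecol e ≠ k₂ ∧
          ∀ k, k = ecol e ∨ k = k₁ ∨ k = k₂ := by
        generalize ecol e = c
        revert c
        decide
      have h0 : ∀ k, M k e = 0 := fun k ↦ hMF k e he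
      have hside : ∀ k, ecol e ≠ k → ∃ i : Fin 3 ⊕ Fin 3, (i = .inl k ∨ i = .inr k) ∧
          (JJ k e ≠ 0 ↔ i = .inl k) ∧ (1 + JJ k e ≠ 0 ↔ i = .inr k) := by
        intro k _
        by_cases h : JJ k e = 0
        · exact ⟨.inr k, by simp [h]⟩
        · have := eq_one_of_ne_zero h
          have h11 : (1 : ZMod 2) + 1 = 0 := by decide
          exact ⟨.inl k, by simp [this, h11]⟩
      obtain ⟨i, hi, hi1, hi2⟩ := hside k₁ h1
      obtain ⟨j, hj, hj1, hj2⟩ := hside k₂ h2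
      refine ⟨i, j, ?_, ?_⟩
      · rintro rfl
        rcases hi with rfl | rfl <;> simp [h12] at hj
      · rintro (k | k)
        · simp only [Sum.elim_inl, Pi.add_apply, h0, add_zero]
          rcases h3 k with rfl | rfl | rfl
          · rw [hJJ0 _ _ (by simp)]
            rcases hi with rfl | rfl <;> rcases hj with rfl | rfl <;> simp [h1, h2]
          · rw [hi1, eq_comm]
            rcases hj with rfl | rfl <;> simp [h12]
          · rw [hj1, eq_comm]
            rcases hi with rfl | rfl <;> simp [h12.symm]
        · simp only [Sum.elim_inr, Pi.add_apply, h0, add_zero]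
          rcases h3 k with rfl | rfl | rfl
          · rw [hJJ0 _ _ (by simp), indic_neg (by simp)]
            rcases hi with rfl | rfl <;> rcases hj with rfl | rfl <;> simp [h1, h2]
          · rw [indic_pos ⟨he, h1⟩, hi2, eq_comm]
            rcases hj with rfl | rfl <;> simp [h12]
          · rw [indic_pos ⟨he, h2⟩, hj2, eq_comm]
            rcases hi with rfl | rfl <;> simp [h12.symm]
    · obtain ⟨k₀, hk₀⟩ := hM e he
      refine ⟨.inl k₀, .inr k₀, by simp, ?_⟩
      rintro (k | k)
      · simp [hJJ0 k e (fun h ↦ he h.1), hk₀]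
      · simp [hJJ0 k e (fun h ↦ he h.1), hk₀, indic, he]

theorem exists_other_colors : ∀ a : Fin 3, ∃ b c, a ≠ b ∧ a ≠ c ∧ b ≠ c ∧
    ∀ k, k = a ∨ k = b ∨ k = c := by
  decide

/-- Distribution of the edges outside the frame over the three pairs of colors, given a coloring in
which the components outside `HV` are monochromatic of a color other than `a`. -/
theorem exists_distribution [Fintype Q] {s t : E → V} {κ : V → Q} {inF : E → Prop}
    {col : V → Fin 3} (a : Fin 3)
    (hpar : boundary (κ ∘ s) (κ ∘ t) (fun e ↦ indic (¬ inF e)) = 0)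
    (Z : E → ZMod 2)
    (hZ : ∀ e, Z e ≠ 0 → ¬ inF e ∧ col (s e) ≠ a ∧ col (t e) ≠ a)
    (hZb : boundary (κ ∘ s) (κ ∘ t) Z = 0)
    (hZ0 : ∀ e, ¬ inF e → col (s e) ≠ a → col (t e) ≠ a → Z e = 0 → col (s e) = col (t e))
    (HV : Q → Prop) (HE : E → Prop)
    (hHV : ∀ q, ¬ HV q → ∃ p, p ≠ a ∧ ∀ v, κ v = q → col v = p)
    (hHE : ∀ e, HE e → ¬ inF e ∧ col (s e) = a ∧ col (t e) = a)
    (hconn : ∀ q r, HV q → HV r → Relation.ReflTransGen (Joins (κ ∘ s) (κ ∘ t) HE) q r) :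
    ∃ M : Fin 3 → E → ZMod 2, (∀ k e, inF e → M k e = 0) ∧
      (∀ e, ¬ inF e → ∃ k₀, ∀ k, M k e ≠ 0 ↔ k = k₀) ∧
      (∀ k e, M k e ≠ 0 → col (s e) ≠ k ∧ col (t e) ≠ k) ∧
      (∀ k, boundary (κ ∘ s) (κ ∘ t) (M k) = 0) := by
  obtain ⟨b, c, hab, hac, hbc, hall⟩ : ∃ b c, a ≠ b ∧ a ≠ c ∧ b ≠ c ∧
      ∀ k, k = a ∨ k = b ∨ k = c := exists_other_colors a
  -- Off `Z`, edges with end colors ab or bb go to class `c`, those with ac or cc to class `b`; aa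
  -- goes to class `b` for the time being, and bc does not occur.
  set Mc : E → ZMod 2 := fun e ↦ indic (¬ inF e ∧ col (s e) ≠ c ∧ col (t e) ≠ c ∧
    (col (s e) ≠ col (t e) ∨ (col (s e) = b ∧ Z e = 0))) with hMc
  set Mb : E → ZMod 2 := (fun e ↦ indic (¬ inF e)) + Z + Mc with hMb
  have hMbb : boundary (κ ∘ s) (κ ∘ t) Mb = boundary (κ ∘ s) (κ ∘ t) Mc := by
    rw [hMb, boundary_add, boundary_add, hpar, hZb, zero_add, zero_add]
  have hMbc : ∀ e, Mb e ≠ 0 → (col (s e) ≠ b ∧ col (t e) ≠ b) := by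
    intro e he
    by_contra hcon
    apply he
    simp only [hMb, hMc, Pi.add_apply]
    by_cases hF : inF e
    · have : Z e = 0 := by by_contra h; exact (hZ e h).1 hF
      simp [indic, hF, this]
    · have hZe := hZ e
      have hZ0e := hZ0 e hF
      have h2 : (1 : ZMod 2) + 1 = 0 := by decide
      by_cases hz : Z e = 0
      · have : col (s e) ≠ c ∧ col (t e) ≠ c ∧
            (col (s e) ≠ col (t e) ∨ (col (s e) = b ∧ Z e = 0)) := by
          rcases hall (col (s e)) with h | h | h <;> rcases hall (col (t e)) with h' | h' | h' <;>
            simp_all [Ne.symm]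
        rw [indic_pos hF, indic_pos ⟨hF, this⟩, hz]
        decide
      · have h3 : ¬ (¬ inF e ∧ col (s e) ≠ c ∧ col (t e) ≠ c ∧
            (col (s e) ≠ col (t e) ∨ (col (s e) = b ∧ Z e = 0))) := by
          have := hZe hz
          rcases hall (col (s e)) with h | h | h <;> rcases hall (col (t e)) with h' | h' | h' <;>
            simp_all
        rw [indic_pos hF, indic_neg h3, eq_one_of_ne_zero hz]
        decide
  have hMcc : ∀ e, Mc e ≠ 0 → (col (s e) ≠ c ∧ col (t e) ≠ c) := by
    intro e he
    have := indic_ne_zero.1 he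
    exact ⟨this.2.1, this.2.2.1⟩
  -- At a component outside `HV`, of color `b` or `c`, the class of that color has no edge; since
  -- both classes have the same boundary, it is zero there.
  obtain ⟨J, hJ, hJb⟩ := exists_tjoin (κ ∘ s) (κ ∘ t) HE HV hconn
    (boundary (κ ∘ s) (κ ∘ t) Mc) (fun q hq ↦ by
      by_contra hqH
      obtain ⟨p, hpa, hp⟩ := hHV q hqH
      have hpbc : p = b ∨ p = c := (hall p).resolve_left hpa
      rcases hpbc with rfl | rfl
      · rw [← hMbb] at hq
        obtain ⟨e, he, hends⟩ := exists_ne_of_boundary_ne_zero hq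
        rcases hends with h | h
        · exact (hMbc e he).1 (hp _ h)
        · exact (hMbc e he).2 (hp _ h)
      · obtain ⟨e, he, hends⟩ := exists_ne_of_boundary_ne_zero hq
        rcases hends with h | h
        · exact (hMcc e he).1 (hp _ h)
        · exact (hMcc e he).2 (hp _ h)) (sum_boundary _ _ _)
  have hJne : ∀ e, J e ≠ 0 → ¬ inF e ∧ col (s e) = a ∧ col (t e) = a := fun e he ↦
    hHE e (by by_contra h; exact he (hJ e h))
  have hM0 : ∀ e, inF e → Z e = 0 ∧ Mb e + J e = 0 ∧ Mc e + J e = 0 := by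
    intro e he
    have h1 : Z e = 0 := by by_contra h; exact (hZ e h).1 he
    have h2 : J e = 0 := by by_contra h; exact (hJne e h).1 he
    simp [h1, h2, hMb, hMc, indic, he]
  -- Adding `J` to both classes switches its edges from one to the other, which is allowed because
  -- their ends have color `a`.
  set M : Fin 3 → E → ZMod 2 := fun k ↦ if k = a then Z else if k = b then Mb + J else Mc + J
    with hM
  have hMa : M a = Z := if_pos rfl
  have hMb' : M b = Mb + J := by simp only [hM, if_neg hab.symm, if_true]
  have hMc' : M c = Mc + J := by simp only [hM, if_neg hac.symm, if_neg hbc.symm]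
  clear_value M Mb Mc
  refine ⟨M, ?_, ?_, ?_, ?_⟩
  · intro k e he
    obtain ⟨h1, h2, h3⟩ := hM0 e he
    rcases hall k with hk | hk | hk <;> rw [hk]
    exacts [hMa ▸ h1, hMb' ▸ h2, hMc' ▸ h3]
  · intro e he
    have hsum : Z e + (Mb e + J e) + (Mc e + J e) = 1 := by
      simp only [hMb, Pi.add_apply, indic_pos he]
      linear_combination add_self_zmod2 (Z e) + add_self_zmod2 (Mc e) + add_self_zmod2 (J e)
    -- The sum 1 alone would also permit `e` to lie in all three classes.
    have hexcl : Z e = 0 ∨ Mc e + J e = 0 := by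
      by_contra! h
      obtain ⟨hz, h⟩ := h
      obtain ⟨_, h1, h2⟩ := hZ e hz
      have h3 : J e = 0 := by by_contra h; exact h1 (hJne e h).2.1
      rw [h3, add_zero, hMc] at h
      obtain ⟨_, h4, h5, h6⟩ := indic_ne_zero.1 h
      have h7 : col (s e) = b := ((hall _).resolve_left h1).resolve_right h4
      have h8 : col (t e) = b := ((hall _).resolve_left h2).resolve_right h5
      rcases h6 with h6 | h6
      exacts [h6 (h7.trans h8.symm), hz h6.2]
    have hfin : ∀ x y z : ZMod 2, x + y + z = 1 → (x = 0 ∨ z = 0) →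
        (x ≠ 0 ∧ y = 0 ∧ z = 0) ∨ (x = 0 ∧ y ≠ 0 ∧ z = 0) ∨ (x = 0 ∧ y = 0 ∧ z ≠ 0) := by decide
    rw [← Pi.add_apply, ← Pi.add_apply Mc, ← hMa, ← hMb', ← hMc'] at hsum
    rw [← Pi.add_apply, ← hMa, ← hMc'] at hexcl
    rcases hfin _ _ _ hsum hexcl with h | h | h
    · refine ⟨a, fun k ↦ ?_⟩
      rcases hall k with hk | hk | hk <;> rw [hk]
      · exact iff_of_true h.1 rfl
      · exact iff_of_false (not_not.2 h.2.1) hab.symm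
      · exact iff_of_false (not_not.2 h.2.2) hac.symm
    · refine ⟨b, fun k ↦ ?_⟩
      rcases hall k with hk | hk | hk <;> rw [hk]
      · exact iff_of_false (not_not.2 h.1) hab
      · exact iff_of_true h.2.1 rfl
      · exact iff_of_false (not_not.2 h.2.2) hbc.symm
    · refine ⟨c, fun k ↦ ?_⟩
      rcases hall k with hk | hk | hk <;> rw [hk]
      · exact iff_of_false (not_not.2 h.1) hac
      · exact iff_of_false (not_not.2 h.2.1) hbc
      · exact iff_of_true h.2.2 rfl
  · intro k e h
    by_cases hj : J e = 0
    · rcases hall k with hk | hk | hk <;> rw [hk] at h ⊢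
      · exact (hZ e (hMa ▸ h)).2
      · rw [hMb', Pi.add_apply, hj, add_zero] at h
        exact hMbc e h
      · rw [hMc', Pi.add_apply, hj, add_zero] at h
        exact hMcc e h
    · obtain ⟨_, h1, h2⟩ := hJne e hj
      rw [h1, h2]
      rcases hall k with hk | hk | hk <;> rw [hk] at h ⊢
      · rw [hMa] at h
        exact absurd h1 (hZ e h).2.1
      · exact ⟨hab, hab⟩
      · exact ⟨hac, hac⟩
  · intro k
    rcases hall k with hk | hk | hk <;> rw [hk]
    · rw [hMa, hZb]
    · rw [hMb', boundary_add, hMbb, hJb]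
      exact funext fun q ↦ add_self_zmod2 _
    · rw [hMc', boundary_add, hJb]
      exact funext fun q ↦ add_self_zmod2 _

/-- Six even sets covering every edge precisely twice. -/
theorem exists_even_double_cover [Fintype V] [Fintype Q] {s t : E → V} {κ : V → Q}
    {inF : E → Prop} {col : V → Fin 3} {ecol : E → Fin 3} (a : Fin 3)
    (hpar : boundary (κ ∘ s) (κ ∘ t) (fun e ↦ indic (¬ inF e)) = 0)
    (HV : Q → Prop) (HE : E → Prop)
    (hcomp : ∀ q, (HV q ∧ GoodAt s t κ inF col ecol q) ∨
      (boundary s t (fun e ↦ indic (inF e ∧ κ (s e) = q)) = 0 ∧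
        ∀ x y, κ x = q → κ y = q →
          Relation.ReflTransGen (Joins s t (fun e ↦ inF e ∧ κ (s e) = q)) x y))
    (hHE : ∀ e, HE e → ¬ inF e ∧ (HV (κ (s e)) ∧ col (s e) = a) ∧ HV (κ (t e)) ∧ col (t e) = a)
    (hconn : ∀ q r, HV q → HV r → Relation.ReflTransGen (Joins (κ ∘ s) (κ ∘ t) HE) q r) :
    ∃ A : Fin 3 ⊕ Fin 3 → E → ZMod 2, (∀ i, boundary s t (A i) = 0) ∧
      ∀ e, ∃ i j, i ≠ j ∧ ∀ l, A l e ≠ 0 ↔ l = i ∨ l = j := by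
  classical
  obtain ⟨b, c, hab, hac, hbc, hall⟩ : ∃ b c, a ≠ b ∧ a ≠ c ∧ b ≠ c ∧
      ∀ k, k = a ∨ k = b ∨ k = c := exists_other_colors a
  set Kt : Q → Prop := fun q ↦ HV q ∧ GoodAt s t κ inF col ecol q with hKt
  -- The color for components not in `Kt`. Inside `HV` it must be `a`, so that the edges of `HE`
  -- keep ends of color `a`; outside it may be anything but `a`.
  set base : Q → Fin 3 := fun q ↦ if HV q then a else b with hbase
  set col₁ : V → Fin 3 := fun v ↦ if Kt (κ v) then col v else base (κ v) with hcol₁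
  set ecol₁ : E → Fin 3 := fun e ↦ if Kt (κ (s e)) then ecol e else base (κ (s e)) with hecol₁
  have good₁ : ∀ q, GoodAt s t κ inF col₁ ecol₁ q := by
    intro q
    by_cases hq : Kt q
    · refine hq.2.congr 1 (fun v hv ↦ ?_) (fun e he ↦ ?_)
      · simp only [hcol₁, hv, if_pos hq, Equiv.Perm.one_apply]
      · simp only [hecol₁, he, if_pos hq, Equiv.Perm.one_apply]
    · obtain ⟨h1, h2⟩ := (hcomp q).resolve_left hq
      refine goodAt_const (base q) h1 h2 (fun v hv ↦ ?_) (fun e he ↦ ?_)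
      · simp only [hcol₁, hv, if_neg hq]
      · simp only [hecol₁, he, if_neg hq]
  obtain ⟨X, Z, hZN, hZb, hX⟩ := exists_even_cut (κ ∘ s) (κ ∘ t)
    (Finset.univ.filter fun e ↦ ¬ inF e ∧ col₁ (s e) ≠ a ∧ col₁ (t e) ≠ a)
    (fun e ↦ indic (col₁ (s e) ≠ col₁ (t e)))
  -- `X` tells on which components to exchange `b` and `c`: off `Z`, an edge avoiding `a` has ends
  -- of different colors exactly if one of its two components is exchanged and the other is not.
  set σ : Q → Equiv.Perm (Fin 3) := fun q ↦ if X q = 0 then 1 else Equiv.swap b c with hσ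
  have hσa : ∀ q, σ q a = a := by
    intro q
    simp only [hσ]
    split_ifs
    · rfl
    · exact Equiv.swap_apply_of_ne_of_ne hab hac
  have hσne : ∀ q p, σ q p ≠ a ↔ p ≠ a := by
    intro q p
    rw [Ne, Ne, ← (σ q).injective.eq_iff (a := p), hσa]
  have hZ : ∀ e, Z e ≠ 0 → ¬ inF e ∧ col₁ (s e) ≠ a ∧ col₁ (t e) ≠ a := by
    intro e he
    by_contra h
    exact he (hZN e (by simpa using h))
  set col₂ : V → Fin 3 := fun v ↦ σ (κ v) (col₁ v) with hcol₂
  have h₂a : ∀ e, Z e ≠ 0 → ¬ inF e ∧ col₂ (s e) ≠ a ∧ col₂ (t e) ≠ a := by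
    intro e he
    simpa only [hcol₂, hσne] using hZ e he
  have h₂b : ∀ e, ¬ inF e → col₂ (s e) ≠ a → col₂ (t e) ≠ a → Z e = 0 → col₂ (s e) = col₂ (t e) := by
    intro e he h1 h2 h0
    simp only [hcol₂] at h1 h2 ⊢
    rw [hσne] at h1 h2
    have h3 := hX e (by simp [he, h1, h2]) h0
    simp only [Function.comp] at h3
    have h4 : col₁ (s e) = b ∨ col₁ (s e) = c := (hall _).resolve_left h1
    have h5 : col₁ (t e) = b ∨ col₁ (t e) = c := (hall _).resolve_left h2
    have hX2 : ∀ q, X q = 0 ∨ X q = 1 := fun q ↦ by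
      generalize X q = x; revert x; decide
    simp only [hσ]
    have h11 : (1 : ZMod 2) + 1 = 0 := by decide
    rcases hX2 (κ (s e)) with h6 | h6 <;> rcases hX2 (κ (t e)) with h7 | h7 <;>
      rcases h4 with h4 | h4 <;> rcases h5 with h5 | h5 <;>
      simp [h4, h5, h6, h7, indic, hbc, hbc.symm, h11] at h3 ⊢
  have h₂c : ∀ q, ¬ HV q → ∃ p, p ≠ a ∧ ∀ v, κ v = q → col₂ v = p := by
    intro q hq
    have hbq : base q = b := if_neg hq
    refine ⟨σ q b, (hσne q b).2 hab.symm, fun v hv ↦ ?_⟩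
    have : ¬ Kt q := fun h ↦ hq h.1
    simp only [hcol₂, hcol₁, hv, if_neg this, hbq]
  have h₂d : ∀ e, HE e → ¬ inF e ∧ col₂ (s e) = a ∧ col₂ (t e) = a := by
    intro e he
    obtain ⟨h1, ⟨h2, h3⟩, h4, h5⟩ := hHE e he
    have hc : ∀ v, HV (κ v) → col v = a → col₁ v = a := by
      intro v hv hva
      simp only [hcol₁, hbase, hva, if_pos hv, ite_self]
    simp only [hcol₂, hc _ h2 h3, hc _ h4 h5, hσa]
    exact ⟨h1, trivial, trivial⟩
  obtain ⟨M, hM1, hM2, hM3, hM4⟩ :=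
    exists_distribution a hpar Z h₂a hZb h₂b HV HE h₂c h₂d hconn
  exact exists_double_cover_of_distribution (ecol := fun e ↦ σ (κ (s e)) (ecol₁ e))
    (fun q ↦ (good₁ q).congr (σ q) (fun v hv ↦ by simp only [hcol₂, hv]) (fun e he ↦ by rw [he]))
    M hM1 hM2 hM3 hM4

end Core

/-! ### Connected components. -/

section Components

variable {α : Type*} {β : Type*} {F G : Graph α β} {x y z : α} {e : β}

theorem reach_symm (h : Relation.ReflTransGen G.Adj x y) : Relation.ReflTransGen G.Adj y x :=
  Std.Symm.symm (r := Relation.ReflTransGen G.Adj) _ _ h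

theorem self_mem_componentAt (hx : x ∈ V(F)) : x ∈ V(componentAt F x) := ⟨hx, .refl⟩

theorem componentAt_le : componentAt F x ≤ F := Graph.induce_le fun _ h ↦ h.1

theorem componentAt_isLink :
    (componentAt F x).IsLink e y z ↔ F.IsLink e y z ∧ Relation.ReflTransGen F.Adj x y := by
  constructor
  · intro h
    exact ⟨h.1, h.2.1.2⟩
  · intro h
    exact ⟨h.1, ⟨h.1.left_mem, h.2⟩, ⟨h.1.right_mem, h.2.tail ⟨e, h.1⟩⟩⟩

theorem componentAt_inc :
    (componentAt F x).Inc e y ↔ F.Inc e y ∧ Relation.ReflTransGen F.Adj x y := by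
  constructor
  · rintro ⟨z, h⟩
    rw [componentAt_isLink] at h
    exact ⟨⟨z, h.1⟩, h.2⟩
  · rintro ⟨⟨z, h⟩, h'⟩
    exact ⟨z, componentAt_isLink.2 ⟨h, h'⟩⟩

theorem componentAt_eq_of_reach (h : Relation.ReflTransGen F.Adj x y) :
    componentAt F x = componentAt F y := by
  unfold componentAt
  congr 1
  ext z
  exact and_congr_right fun _ ↦ ⟨fun h' ↦ (reach_symm h).trans h', fun h' ↦ h.trans h'⟩

theorem reach_componentAt (hxy : Relation.ReflTransGen F.Adj x y)
    (h : Relation.ReflTransGen F.Adj y z) : Relation.ReflTransGen (componentAt F x).Adj y z := by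
  induction h with
  | refl => exact .refl
  | @tail u w hu hw ih =>
    obtain ⟨e, he⟩ := hw
    exact ih.tail ⟨e, componentAt_isLink.2 ⟨he, hxy.trans hu⟩⟩

theorem degree_componentAt (hxy : Relation.ReflTransGen F.Adj x y) :
    degree (componentAt F x) y = degree F y := by
  have h1 : (componentAt F x).incidenceSet y = F.incidenceSet y := by
    ext e
    simp [componentAt_inc, hxy]
  have h2 : (componentAt F x).loopSet y = F.loopSet y := by
    ext e
    simp [← Graph.isLink_self_iff, componentAt_isLink, hxy]
  rw [degree, degree, h1, h2]

theorem isCycle_componentAt (hfin : IsFinite F) (hx : x ∈ V(F))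
    (hd : ∀ y ∈ V(F), degree F y = 2) : IsCycle (componentAt F x) where
  finite := ⟨hfin.1.subset fun _ h ↦ h.1, hfin.2.subset componentAt_le.edgeSet_mono⟩
  connected := ⟨⟨x, self_mem_componentAt hx⟩, fun y hy z hz ↦
    reach_componentAt hy.2 ((reach_symm hy.2).trans hz.2)⟩
  degree_eq y hy := by rw [degree_componentAt hy.2, hd y hy.1]

theorem degree_eq_of_loopless (hG : G.Loopless) (x : α) : degree G x = (G.incidenceSet x).encard := by
  have : G.loopSet x = ∅ := by
    ext e
    simp
  rw [degree, this, Set.encard_empty, add_zero]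

end Components

/-! ### From even edge sets to cycles. -/

section EvenSets

variable {α : Type*} {β : Type*}

/-- The subgraph formed by a set of edges and their ends. -/
def edgeSubgraph (G : Graph α β) (A : Set β) : Graph α β :=
  (G.restrict A).induce {x | ∃ e ∈ A, G.Inc e x}

variable {G : Graph α β} {A : Set β} {x y : α} {e : β}

theorem edgeSubgraph_isLink : (edgeSubgraph G A).IsLink e x y ↔ e ∈ A ∧ G.IsLink e x y := by
  simp only [edgeSubgraph, Graph.induce_isLink, Graph.restrict_isLink, Set.mem_ofPred_eq]
  exact ⟨fun h ↦ h.1, fun h ↦ ⟨h, ⟨e, h.1, h.2.inc_left⟩, ⟨e, h.1, h.2.inc_right⟩⟩⟩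

theorem edgeSubgraph_inc : (edgeSubgraph G A).Inc e x ↔ e ∈ A ∧ G.Inc e x := by
  simp only [Graph.Inc, edgeSubgraph_isLink, exists_and_left]

theorem edgeSubgraph_le : edgeSubgraph G A ≤ G where
  vertexSet_mono := by
    rintro x ⟨e, _, he⟩
    exact he.vertex_mem
  isLink_mono _ _ _ h := (edgeSubgraph_isLink.1 h).2

/-- A family of even edge sets of a cubic graph which covers every edge precisely twice yields a
cycle double cover. -/
theorem hasCycleDoubleCover_of_even {k : ℕ} (hfin : IsFinite G) (hloop : G.Loopless)
    (hcubic : IsCubic G) (A : Fin k → Set β)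
    (heven : ∀ i, ∀ x ∈ V(G), Even {e | e ∈ A i ∧ G.Inc e x}.ncard)
    (hcover : ∀ e ∈ E(G), ∃ i j, i ≠ j ∧ ∀ l, e ∈ A l ↔ l = i ∨ l = j) :
    HasCycleDoubleCover k G := by
  have hsubfin (i) : IsFinite (edgeSubgraph G (A i)) :=
    ⟨hfin.1.subset edgeSubgraph_le.vertexSet_mono, hfin.2.subset edgeSubgraph_le.edgeSet_mono⟩
  have hthree (x) (hx : x ∈ V(G)) : (G.incidenceSet x).encard = 3 := by
    rw [← degree_eq_of_loopless hloop, hcubic x hx]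
  have hset (i x) : (edgeSubgraph G (A i)).incidenceSet x = {e | e ∈ A i ∧ G.Inc e x} := by
    ext e
    simp [edgeSubgraph_inc]
  have htwo (i x) (hx : x ∈ V(edgeSubgraph G (A i))) :
      ((edgeSubgraph G (A i)).incidenceSet x).encard = 2 := by
    have hxG := edgeSubgraph_le.vertexSet_mono hx
    obtain ⟨e, heA, hex⟩ := hx
    have hev := heven i x hxG
    have hsub : {e | e ∈ A i ∧ G.Inc e x} ⊆ G.incidenceSet x := fun f hf ↦ hf.2
    have hf : (G.incidenceSet x).Finite := Set.finite_of_encard_eq_coe (hthree x hxG)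
    have hle := Set.ncard_le_ncard hsub hf
    have h3 : (G.incidenceSet x).ncard = 3 := by
      rw [Set.ncard_def, hthree x hxG]; rfl
    have hpos : 0 < {e | e ∈ A i ∧ G.Inc e x}.ncard :=
      (Set.ncard_pos (hf.subset hsub)).2 ⟨e, heA, hex⟩
    have h2 : {e | e ∈ A i ∧ G.Inc e x}.ncard = 2 := by
      obtain ⟨m, hm⟩ := hev
      omega
    rw [hset, ← (hf.subset hsub).cast_ncard_eq, h2]
    rfl
  have hdeg (i) : ∀ y ∈ V(edgeSubgraph G (A i)), degree (edgeSubgraph G (A i)) y = 2 := by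
    intro y hy
    rw [degree_eq_of_loopless (hloop.anti edgeSubgraph_le), htwo i y hy]
  set P : Fin k → Set (Graph α β) := fun i ↦ {C | IsComponent (edgeSubgraph G (A i)) C} with hP
  have hinc {i x y} (hxy : Relation.ReflTransGen (edgeSubgraph G (A i)).Adj x y) :
      (componentAt (edgeSubgraph G (A i)) x).incidenceSet y =
        (edgeSubgraph G (A i)).incidenceSet y := by
    ext e
    simp [componentAt_inc, hxy]
  -- The cover is a set, so no cycle may arise from two indices. If one did, the third edge `g` at a
  -- vertex `x` of it would lie in some other `A l`; this uses two of the three edges at `x`, hence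
  -- an edge of the cycle, which is then covered three times.
  have hdisj : ∀ i j, i ≠ j → Disjoint (P i) (P j) := by
    intro i j hij
    rw [Set.disjoint_left]
    rintro C ⟨x, hx, rfl⟩ ⟨y, hy, hC⟩
    have hxC := self_mem_componentAt hx
    have h1 := hinc (Relation.ReflTransGen.refl (a := x) (r := (edgeSubgraph G (A i)).Adj))
    have hxC' := hxC
    rw [hC] at h1 hxC'
    rw [hinc hxC'.2, hset, hset] at h1
    have hxG := edgeSubgraph_le.vertexSet_mono hx
    have h2i := htwo i x hx
    rw [hset] at h2i
    have hlt : ∃ g, G.Inc g x ∧ g ∉ A i := by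
      by_contra! hcon
      have : G.incidenceSet x ⊆ {e | e ∈ A i ∧ G.Inc e x} := fun g hg ↦ ⟨hcon g hg, hg⟩
      have := Set.encard_le_encard this
      rw [hthree x hxG, h2i] at this
      exact absurd this (by decide)
    obtain ⟨g, hgx, hgi⟩ := hlt
    have hgj : g ∉ A j := fun h ↦ hgi (h1 ▸ (⟨h, hgx⟩ : g ∈ {e | e ∈ A j ∧ G.Inc e x}) :
      g ∈ {e | e ∈ A i ∧ G.Inc e x}).1
    obtain ⟨l, _, _, hl⟩ := hcover g hgx.edge_mem
    have hgl : g ∈ A l := (hl l).2 (.inl rfl)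
    have h2l := htwo l x ⟨g, hgl, hgx⟩
    rw [hset] at h2l
    have hmeet : ∃ e, e ∈ A i ∧ e ∈ A l ∧ G.Inc e x := by
      by_contra! hcon
      have hd : Disjoint {e | e ∈ A i ∧ G.Inc e x} {e | e ∈ A l ∧ G.Inc e x} := by
        rw [Set.disjoint_left]
        exact fun e h h' ↦ hcon e h.1 h'.1 h.2
      have hsub : {e | e ∈ A i ∧ G.Inc e x} ∪ {e | e ∈ A l ∧ G.Inc e x} ⊆ G.incidenceSet x :=
        Set.union_subset (fun e h ↦ h.2) (fun e h ↦ h.2)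
      have := Set.encard_le_encard hsub
      rw [Set.encard_union_eq hd, h2i, h2l, hthree x hxG] at this
      exact absurd this (by decide)
    obtain ⟨e, hei, hel, hex⟩ := hmeet
    have hej : e ∈ A j := (h1 ▸ (⟨hei, hex⟩ : e ∈ {e | e ∈ A i ∧ G.Inc e x}) :
      e ∈ {e | e ∈ A j ∧ G.Inc e x}).1
    obtain ⟨i', j', _, h'⟩ := hcover e hex.edge_mem
    have hli : l ≠ i := by rintro rfl; exact hgi hgl
    have hlj : l ≠ j := by rintro rfl; exact hgj hgl
    have := (h' i).1 hei
    have := (h' j).1 hej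
    have := (h' l).1 hel
    grind
  refine ⟨⋃ i, P i, ⟨fun C hC ↦ ?_, fun e he ↦ ?_⟩, P, rfl, hdisj, ?_⟩
  · obtain ⟨i, x, hx, rfl⟩ := Set.mem_iUnion.1 hC
    exact ⟨componentAt_le.trans edgeSubgraph_le, isCycle_componentAt (hsubfin i) hx (hdeg i)⟩
  · obtain ⟨i, j, hij, hl⟩ := hcover e he
    obtain ⟨x, y, hxy⟩ := G.exists_isLink_of_mem_edgeSet he
    have hmem (l) (hel : e ∈ A l) : componentAt (edgeSubgraph G (A l)) x ∈ P l :=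
      ⟨x, ⟨e, hel, hxy.inc_left⟩, rfl⟩
    have heq : {C ∈ ⋃ i, P i | e ∈ E(C)} = {componentAt (edgeSubgraph G (A i)) x,
        componentAt (edgeSubgraph G (A j)) x} := by
      ext C
      constructor
      · rintro ⟨hC, heC⟩
        obtain ⟨l, z, hz, rfl⟩ := Set.mem_iUnion.1 hC
        obtain ⟨u, w, huw⟩ := Graph.exists_isLink_of_mem_edgeSet heC
        rw [componentAt_isLink, edgeSubgraph_isLink] at huw
        have hzx : Relation.ReflTransGen (edgeSubgraph G (A l)).Adj z x := by
          rcases hxy.left_eq_or_eq huw.1.2 with rfl | rfl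
          · exact huw.2
          · exact huw.2.tail ⟨e, edgeSubgraph_isLink.2 huw.1⟩
        rw [componentAt_eq_of_reach hzx]
        rcases (hl l).1 huw.1.1 with rfl | rfl
        · exact .inl rfl
        · exact .inr rfl
      · have hin (l) (hel : e ∈ A l) : componentAt (edgeSubgraph G (A l)) x ∈
            {C ∈ ⋃ i, P i | e ∈ E(C)} :=
          ⟨Set.mem_iUnion.2 ⟨l, hmem l hel⟩, Graph.IsLink.edge_mem
            (componentAt_isLink.2 ⟨edgeSubgraph_isLink.2 ⟨hel, hxy⟩, .refl⟩)⟩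
        rintro (rfl | rfl)
        · exact hin i ((hl i).2 (.inl rfl))
        · exact hin j ((hl j).2 (.inr rfl))
    rw [heq]
    refine Set.encard_pair fun h ↦ ?_
    exact Set.disjoint_left.1 (hdisj i j hij) (hmem i ((hl i).2 (.inl rfl)))
      (h ▸ hmem j ((hl j).2 (.inr rfl)))
  · rintro i C ⟨x, hx, rfl⟩ D ⟨y, hy, rfl⟩ hne
    rw [Set.disjoint_left]
    intro e he he'
    obtain ⟨u, w, h⟩ := Graph.exists_isLink_of_mem_edgeSet he
    obtain ⟨u', w', h'⟩ := Graph.exists_isLink_of_mem_edgeSet he'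
    rw [componentAt_isLink] at h h'
    refine hne ((componentAt_eq_of_reach h.2).trans (.trans ?_ (componentAt_eq_of_reach h'.2).symm))
    rcases h.1.left_eq_or_eq h'.1 with rfl | rfl
    · rfl
    · exact (componentAt_eq_of_reach (.single ⟨e, h'.1⟩)).symm

end EvenSets

/-! ### Three colors at a cubic vertex. -/

section ThreeColors

theorem exists_eq_range_of_injOn {β : Type*} {S : Set β} (hS : S.encard = 3) {c : β → Fin 3}
    (hc : Set.InjOn c S) : ∃ f : Fin 3 → β, S = Set.range f ∧ ∀ i, c (f i) = i := by
  have h1 : (c '' S).encard = (Set.univ : Set (Fin 3)).encard := by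
    rw [hc.encard_image, hS, Set.encard_univ]
    simp
  have h2 : c '' S = Set.univ := Set.Finite.eq_of_subset_of_encard_le (Set.toFinite _)
    (Set.subset_univ _) h1.ge
  have h3 : ∀ i, ∃ e ∈ S, c e = i := fun i ↦ by
    have : i ∈ c '' S := h2 ▸ Set.mem_univ i
    exact this
  choose f hfS hf using h3
  refine ⟨f, Set.Subset.antisymm (fun e he ↦ ⟨c e, hc (hfS _) he (hf _)⟩) ?_, hf⟩
  rintro _ ⟨i, rfl⟩
  exact hfS i

theorem encard_ne_eq_two {β : Type*} {f : Fin 3 → β} {c : β → Fin 3} (hf : ∀ i, c (f i) = i)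
    (k : Fin 3) : {e | e ∈ Set.range f ∧ c e ≠ k}.encard = 2 := by
  have h : {e | e ∈ Set.range f ∧ c e ≠ k} = f '' {i | i ≠ k} := by
    ext e
    constructor
    · rintro ⟨⟨i, rfl⟩, h⟩
      exact ⟨i, by rwa [hf] at h, rfl⟩
    · rintro ⟨i, h, rfl⟩
      exact ⟨⟨i, rfl⟩, by rwa [hf]⟩
  have hinj : Function.Injective f := fun i j hij ↦ by rw [← hf i, hij, hf]
  rw [h, hinj.encard_image]
  have h2 (j : Fin 3) : {i : Fin 3 | i ≠ j}.ncard = 2 := by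
    rw [Set.ncard_eq_toFinset_card']
    decide +revert
  rw [← (Set.toFinite _).cast_ncard_eq, h2]
  rfl

end ThreeColors

/-! ### Kotzig-colorings and paths. -/

section Kotzig

variable {α : Type*} {β : Type*} {K P : Graph α β} {a b x : α}

/-- Deleting one color class leaves a 2-regular graph; its component at `z` is a bicolored cycle,
hence hamiltonian. -/
theorem IsKotzigColoring.reach {c : β → Fin 3} (hfin : IsFinite K) (hloop : K.Loopless)
    (hcubic : IsCubic K) (hc : IsKotzigColoring K c) (k : Fin 3) {z w : α} (hz : z ∈ V(K))
    (hw : w ∈ V(K)) : Relation.ReflTransGen (K.restrict {e | c e ≠ k}).Adj z w := by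
  have hle : K.restrict {e | c e ≠ k} ≤ K := Graph.restrict_le
  have hdeg : ∀ y ∈ V(K), degree (K.restrict {e | c e ≠ k}) y = 2 := by
    intro y hy
    obtain ⟨f, hS, hf⟩ := exists_eq_range_of_injOn (S := K.incidenceSet y) (c := c)
      (by rw [← degree_eq_of_loopless hloop, hcubic y hy])
      (fun e he f hf hef ↦ by
        by_contra hne
        exact hc.1 y e f he hf hne hef)
    rw [degree_eq_of_loopless (hloop.anti hle), ← encard_ne_eq_two hf k, ← hS]
    congr 1
    ext e
    simp
  have hcyc := isCycle_componentAt (F := K.restrict {e | c e ≠ k}) (x := z)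
    ⟨hfin.1, hfin.2.subset hle.edgeSet_mono⟩ hz hdeg
  have hV := hc.2 _ (componentAt_le.trans hle) hcyc (by
    obtain ⟨b, d, _, _, _, hall⟩ := exists_other_colors k
    refine ⟨b, d, fun e he ↦ (hall (c e)).resolve_left ?_⟩
    exact ((componentAt_le (F := K.restrict {e | c e ≠ k})).edgeSet_mono he).2)
  rw [← hV] at hw
  exact hw.2

theorem IsPathBetween.reach (hP : IsPathBetween P a b) (hx : x ∈ V(P)) :
    Relation.ReflTransGen P.Adj a x := by
  obtain ⟨n, p, q, rfl, rfl, hinj, hV, hE, hlink⟩ := hP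
  rw [hV] at hx
  obtain ⟨i, hi, rfl⟩ := hx
  rw [Set.mem_Iic] at hi
  induction i with
  | zero => exact .refl
  | succ i ih => exact (ih (by omega)).tail ⟨_, hlink i (by omega)⟩

theorem IsPathBetween.mem_right (hP : IsPathBetween P a b) : b ∈ V(P) := by
  obtain ⟨n, p, q, rfl, rfl, hinj, hV, hE, hlink⟩ := hP
  rw [hV]
  exact ⟨n, Set.mem_Iic.2 le_rfl, rfl⟩

theorem IsPathBetween.exists_inc_left (hP : IsPathBetween P a b) (hab : a ≠ b) :
    ∃ e, P.Inc e a := by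
  obtain ⟨n, p, q, rfl, rfl, hinj, hV, hE, hlink⟩ := hP
  have hn : n ≠ 0 := by rintro rfl; exact hab rfl
  exact ⟨q 0, _, hlink 0 (by omega)⟩

theorem IsPathBetween.encard_inner (hP : IsPathBetween P a b) (hx : x ∈ V(P)) (hxa : x ≠ a)
    (hxb : x ≠ b) : (P.incidenceSet x).encard = 2 := by
  obtain ⟨n, p, q, rfl, rfl, hinj, hV, hE, hlink⟩ := hP
  rw [hV] at hx
  obtain ⟨i, hi, rfl⟩ := hx
  rw [Set.mem_Iic] at hi
  have hi0 : i ≠ 0 := by rintro rfl; exact hxa rfl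
  have hin : i ≠ n := by rintro rfl; exact hxb rfl
  obtain ⟨j, rfl⟩ := Nat.exists_eq_succ_of_ne_zero hi0
  have hset : P.incidenceSet (p (j + 1)) = {q j, q (j + 1)} := by
    ext f
    constructor
    · intro hf
      have hfE := Graph.Inc.edge_mem hf
      rw [hE] at hfE
      obtain ⟨m, hm, rfl⟩ := hfE
      rw [Set.mem_Iio] at hm
      rcases Graph.Inc.eq_or_eq_of_isLink hf (hlink m hm) with h | h
      · have := hinj (Set.mem_Iic.2 hi) (Set.mem_Iic.2 hm.le) h
        subst this
        exact .inr rfl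
      · have := hinj (Set.mem_Iic.2 hi) (Set.mem_Iic.2 hm) h
        obtain rfl : j = m := by omega
        exact .inl rfl
    · rintro (rfl | rfl)
      · exact (hlink j (by omega)).inc_right
      · exact (hlink (j + 1) (by omega)).inc_left
  rw [hset]
  -- Nothing was assumed about distinctness of the `q i`; equality here would make `p j` coincide
  -- with `p (j + 1)` or `p (j + 2)`.
  refine Set.encard_pair fun h ↦ ?_
  have h1 := hlink j (by omega)
  rw [h] at h1
  rcases h1.left_eq_or_eq (hlink (j + 1) (by omega)) with h2 | h2
  · have := hinj (Set.mem_Iic.2 (by omega)) (Set.mem_Iic.2 (by omega)) h2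
    omega
  · have := hinj (Set.mem_Iic.2 (by omega)) (Set.mem_Iic.2 (by omega)) h2
    omega

end Kotzig

/-! ### Perfect colorings of subdivided Kotzig graphs. -/

section Perfect

variable {α : Type u} {β : Type v}

theorem reach_of_path {L P : Graph α β} {a x : α} {φ : TotalColoring α β} {k m : Fin 3} (hPL : P ≤ L)
    (hm : m ≠ k) (hcol : ∀ f ∈ E(P), m = φ.edgeColor f) (h : Relation.ReflTransGen P.Adj a x) :
    Relation.ReflTransGen (L.restrict {e | φ.edgeColor e ≠ k}).Adj a x := by
  refine Relation.ReflTransGen.mono (fun u v huv ↦ ?_) _ _ h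
  obtain ⟨f, hf⟩ := huv
  refine ⟨f, ?_⟩
  rw [Graph.restrict_isLink]
  exact ⟨by rw [Set.mem_ofPred_eq, ← hcol f hf.edge_mem]; exact hm, hf.mono hPL⟩

/-- A perfectly colored subdivision of a Kotzig graph: at the vertices of the Kotzig graph all three
colors occur, all other vertices are monochromatic and `2`-valent, and any two colors
connect the vertices at which they occur. -/
theorem IsPerfectOnSubdivision.exists_branch_set {L : Graph α β} {φ : TotalColoring α β}
    (hloop : L.Loopless) (h : IsPerfectOnSubdivision L φ) :
    ∃ B : Set α, (∀ x ∈ B, ∃ f : Fin 3 → β, ∀ i, L.Inc (f i) x ∧ φ.edgeColor (f i) = i) ∧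
      (∀ x ∈ V(L), x ∉ B → (L.incidenceSet x).encard = 2 ∧
        (∀ e, L.Inc e x → φ.edgeColor e = φ.vertexColor x) ∧
        ∀ k, φ.vertexColor x ≠ k → ∃ z ∈ B,
          Relation.ReflTransGen (L.restrict {e | φ.edgeColor e ≠ k}).Adj z x) ∧
      ∀ k, ∀ z ∈ B, ∀ w ∈ B,
        Relation.ReflTransGen (L.restrict {e | φ.edgeColor e ≠ k}).Adj z w := by
  obtain ⟨α', β', K, s, hK, _, hvert, c, hc, hKc⟩ := h
  have hbranch {e x y} (hl : K.IsLink e x y) : s.branch x ≠ s.branch y := fun h ↦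
    (hK.loopless.not_isLoopAt e x) (by
      have := s.branch_injOn hl.left_mem hl.right_mem h
      rw [← this] at hl
      exact hl)
  refine ⟨s.branch '' V(K), ?_, ?_, ?_⟩
  · rintro _ ⟨z, hz, rfl⟩
    obtain ⟨f, hS, hf⟩ := exists_eq_range_of_injOn (S := K.incidenceSet z) (c := c)
      (by rw [← degree_eq_of_loopless hK.loopless, hK.cubic z hz])
      (fun e he f hf hef ↦ by
        by_contra hne
        exact hKc.1 z e f he hf hne hef)
    have hg : ∀ i, ∃ g, L.Inc g (s.branch z) ∧ φ.edgeColor g = i := by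
      intro i
      have hfi : f i ∈ K.incidenceSet z := hS ▸ ⟨i, rfl⟩
      obtain ⟨y, hl⟩ := hfi
      obtain ⟨g, hg⟩ := (s.isPath _ _ _ hl).exists_inc_left (hbranch hl)
      exact ⟨g, hg.mono (s.path_le _ hl.edge_mem), by
        rw [← hc _ hl.edge_mem g hg.edge_mem, hf]⟩
    choose g hg using hg
    exact ⟨g, hg⟩
  · intro x hx hxB
    rw [s.vertexSet_eq] at hx
    obtain ⟨e, he, hxe⟩ := Set.mem_iUnion₂.1 (hx.resolve_left hxB)
    obtain ⟨y, z, hl⟩ := K.exists_isLink_of_mem_edgeSet he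
    have hpath := s.isPath e y z hl
    have hxy : x ≠ s.branch y := fun h ↦ hxB ⟨y, hl.left_mem, h.symm⟩
    have hxz : x ≠ s.branch z := fun h ↦ hxB ⟨z, hl.right_mem, h.symm⟩
    -- Paths of distinct edges meet in branch vertices only, so all edges at `x` belong to this one
    -- path.
    have hset : L.incidenceSet x = (s.path e).incidenceSet x := by
      ext f
      constructor
      · intro hf
        have hfE := Graph.Inc.edge_mem hf
        rw [s.edgeSet_eq] at hfE
        obtain ⟨e', he', hfe'⟩ := Set.mem_iUnion₂.1 hfE
        have hf' : (s.path e').Inc f x := ((s.path_le e' he').inc_congr hfe').2 hf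
        by_cases hee : e = e'
        · rw [hee]
          exact hf'
        · exact absurd (s.inter_subset e he e' he' hee ⟨hxe, hf'.vertex_mem⟩) hxB
      · exact fun hf ↦ Graph.Inc.mono (s.path_le e he) hf
    have h2 : (L.incidenceSet x).encard = 2 := by
      rw [hset]
      exact hpath.encard_inner hxe hxy hxz
    have hxL : x ∈ V(L) := (s.path_le e he).vertexSet_mono hxe
    have hcol : ∀ f, L.Inc f x → φ.edgeColor f = φ.vertexColor x := fun f hf ↦
      (hvert x hxL (by rw [degree_eq_of_loopless hloop, h2]) f hf).symm
    refine ⟨h2, hcol, fun k hk ↦ ⟨s.branch y, ⟨y, hl.left_mem, rfl⟩, ?_⟩⟩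
    -- The whole path has the color of `x`, which is not `k`, so it survives the deletion of color
    -- `k`.
    refine reach_of_path (m := c e) (s.path_le e he) ?_ (hc e he) (hpath.reach hxe)
    obtain ⟨f, hf⟩ : (L.incidenceSet x).Nonempty := by
      rw [← Set.encard_pos, h2]; decide
    rw [← hcol f hf] at hk
    rw [hset] at hf
    rwa [hc e he f (Graph.Inc.edge_mem hf)]
  · rintro k _ ⟨z, hz, rfl⟩ _ ⟨w, hw, rfl⟩
    have := IsKotzigColoring.reach hK.finite hK.loopless hK.cubic hKc k hz hw
    induction this with
    | refl => exact .refl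
    | @tail u v _ huv ih =>
      obtain ⟨e, he⟩ := huv
      rw [Graph.restrict_isLink] at he
      have hp := s.isPath _ _ _ he.2
      exact (ih he.2.left_mem).trans (reach_of_path (s.path_le e he.2.edge_mem) he.1
        (hc e he.2.edge_mem) (hp.reach hp.mem_right))

end Perfect

/-! ### Translation between `Graph` and mod 2 boundaries. -/

section Translation

variable {α : Type u} {β : Type v} {G F R : Graph α β}

/-- Looplessness is essential: a loop cancels in the boundary but counts once as an incident edge.
-/
theorem boundary_indic_eq_ncard [Fintype E(G)] (hloop : G.Loopless) {s t : E(G) → V(G)}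
    (hst : ∀ e : E(G), G.IsLink (e : β) (s e : α) (t e : α)) (D : Set β) (v : V(G)) :
    boundary s t (fun e ↦ indic ((e : β) ∈ D)) v =
      ({e | e ∈ D ∧ G.Inc e (v : α)}.ncard : ZMod 2) := by
  classical
  have h1 : ∀ e : E(G), indic ((e : β) ∈ D) * (indic (s e = v) + indic (t e = v)) =
      if (e : β) ∈ D ∧ G.Inc (e : β) (v : α) then 1 else 0 := by
    intro e
    have hne : s e ≠ t e := fun h ↦ hloop.not_isLoopAt (e : β) (s e : α) (by
      have := hst e
      rw [← h] at this
      exact this)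
    by_cases hD : (e : β) ∈ D
    · by_cases hs : s e = v
      · have ht : t e ≠ v := fun h ↦ hne (hs.trans h.symm)
        have : G.Inc (e : β) (v : α) := hs ▸ (hst e).inc_left
        simp [indic, hD, hs, ht, this]
      · by_cases ht : t e = v
        · have : G.Inc (e : β) (v : α) := ht ▸ (hst e).inc_right
          simp [indic, hD, hs, ht, this]
        · have : ¬ G.Inc (e : β) (v : α) := fun h ↦ by
            rcases h.eq_or_eq_of_isLink (hst e) with h | h
            exacts [hs (Subtype.ext h.symm), ht (Subtype.ext h.symm)]
          simp [indic, hs, ht, this]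
    · simp [indic, hD]
  unfold boundary
  simp_rw [h1]
  rw [Finset.sum_boole]
  congr 1
  rw [← Set.ncard_coe_finset, ← Set.ncard_image_of_injective _ Subtype.val_injective]
  congr 1
  ext e
  simp only [Finset.coe_filter, Finset.mem_univ, true_and, Set.mem_image, Set.mem_ofPred_eq,
    Subtype.exists, exists_and_right, exists_eq_right]
  exact ⟨fun ⟨⟨_, h⟩, h'⟩ ↦ ⟨h, h'⟩, fun h ↦ ⟨⟨h.2.edge_mem, h.1⟩, h.2⟩⟩

theorem reach_joins {s t : E(G) → V(G)}
    (hst : ∀ e : E(G), G.IsLink (e : β) (s e : α) (t e : α)) (hR : R ≤ G) {D : E(G) → Prop}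
    (hD : ∀ e : E(G), (e : β) ∈ E(R) → D e) {x y : V(G)}
    (h : Relation.ReflTransGen R.Adj (x : α) (y : α)) :
    Relation.ReflTransGen (Joins s t D) x y := by
  obtain ⟨x, hx⟩ := x
  obtain ⟨y, hy⟩ := y
  dsimp only at h
  induction h with
  | refl => exact .refl
  | @tail u w _ huw ih =>
    obtain ⟨e, he⟩ := huw
    have heG := he.mono hR
    refine (ih heG.left_mem).tail ⟨⟨e, heG.edge_mem⟩, hD _ he.edge_mem, ?_⟩
    rcases (hst ⟨e, heG.edge_mem⟩).eq_and_eq_or_eq_and_eq heG with ⟨h1, h2⟩ | ⟨h1, h2⟩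
    · exact .inl ⟨Subtype.ext h1, Subtype.ext h2⟩
    · exact .inr ⟨Subtype.ext h1, Subtype.ext h2⟩

theorem natCast_eq_zero_of_encard_eq_two {S : Set β} (h : S.encard = 2) :
    (S.ncard : ZMod 2) = 0 := by
  rw [Set.ncard_def, h]
  rfl

theorem contraction_isLink {e : β} {L L' : Graph α β} (h : (contraction G F).IsLink e L L') :
    ∃ x y, G.IsLink e x y ∧ L = componentAt F x ∧ L' = componentAt F y ∧
      componentAt F x ≠ componentAt F y := by
  unfold contraction at h
  rw [Graph.deleteEdges_isLink] at h
  obtain ⟨h1, h2⟩ := h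
  have h3 := h1
  rw [Graph.map_isLink] at h3
  obtain ⟨x, y, hxy, rfl, rfl⟩ := h3
  refine ⟨x, y, hxy, rfl, rfl, fun heq ↦ h2 ⟨componentAt F x, ?_⟩⟩
  rw [← Graph.isLink_self_iff]
  nth_rw 2 [heq]
  exact h1

/-- The perfectly colored K-components satisfy the connectivity and parity conditions. -/
theorem goodAt_of_isPerfectOnSubdivision [Fintype E(G)] {Q : Type*} (hloop : G.Loopless)
    (hcubic : IsCubic G) {s t : E(G) → V(G)}
    (hst : ∀ e : E(G), G.IsLink (e : β) (s e : α) (t e : α)) {κ : V(G) → Q} {q : Q}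
    {L : Graph α β} (hFG : F ≤ G) (hL : L ≤ F) (hκ : ∀ v : V(G), κ v = q ↔ (v : α) ∈ V(L))
    (hE : ∀ e : E(G), (e : β) ∈ E(F) ∧ κ (s e) = q ↔ (e : β) ∈ E(L))
    {φ : TotalColoring α β} (hφ : IsPerfectOnSubdivision L φ) :
    GoodAt s t κ (fun e ↦ (e : β) ∈ E(F)) (fun v ↦ φ.vertexColor v) (fun e ↦ φ.edgeColor e) q := by
  have hLG := hL.trans hFG
  have hLl : L.Loopless := hloop.anti hLG
  obtain ⟨B, hB3, hB2, hBc⟩ := hφ.exists_branch_set hLl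
  -- Three edges of `L` with distinct colors exhaust the three edges of `G` at `x`.
  have hBG : ∀ x ∈ B, ∃ f : Fin 3 → β, (∀ i, φ.edgeColor (f i) = i) ∧
      G.incidenceSet x = Set.range f ∧ L.incidenceSet x = Set.range f := by
    intro x hx
    obtain ⟨f, hf⟩ := hB3 x hx
    have hinj : Function.Injective f := fun i j hij ↦ by rw [← (hf i).2, hij, (hf j).2]
    have hsub : Set.range f ⊆ L.incidenceSet x := by
      rintro _ ⟨i, rfl⟩
      exact (hf i).1
    have hsub' : L.incidenceSet x ⊆ G.incidenceSet x := fun e he ↦ Graph.Inc.mono hLG he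
    have h3 : (G.incidenceSet x).encard = 3 := by
      rw [← degree_eq_of_loopless hloop, hcubic x ((hf 0).1.mono hLG).vertex_mem]
    have hr : (Set.range f).encard = 3 := by
      rw [← Set.image_univ, hinj.encard_image, Set.encard_univ]
      simp
    have heq : Set.range f = G.incidenceSet x := (Set.finite_range f).eq_of_subset_of_encard_le (hsub.trans hsub')
      (by rw [h3, hr])
    exact ⟨f, fun i ↦ (hf i).2, heq.symm, (heq ▸ hsub').antisymm hsub⟩
  intro k
  have hcp : ∀ e : E(G), colorPart s κ (fun e ↦ (e : β) ∈ E(F)) (fun e ↦ φ.edgeColor e) q k e ↔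
      (e : β) ∈ {e | e ∈ E(L) ∧ φ.edgeColor e ≠ k} := by
    intro e
    unfold colorPart
    rw [← and_assoc, hE]
    rfl
  constructor
  · funext v
    simp_rw [hcp]
    rw [boundary_indic_eq_ncard hloop hst]
    have hset : {e | e ∈ {e | e ∈ E(L) ∧ φ.edgeColor e ≠ k} ∧ G.Inc e (v : α)} =
        {e | e ∈ L.incidenceSet (v : α) ∧ φ.edgeColor e ≠ k} := by
      ext e
      constructor
      · rintro ⟨⟨h1, h2⟩, h3⟩
        exact ⟨(hLG.inc_congr h1).2 h3, h2⟩
      · rintro ⟨h1, h2⟩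
        exact ⟨⟨Graph.Inc.edge_mem h1, h2⟩, Graph.Inc.mono hLG h1⟩
    rw [hset, Pi.zero_apply]
    have hempty : {e | e ∈ L.incidenceSet (v : α) ∧ φ.edgeColor e ≠ k} = ∅ →
        ({e | e ∈ L.incidenceSet (v : α) ∧ φ.edgeColor e ≠ k}.ncard : ZMod 2) = 0 := by
      intro h
      rw [h, Set.ncard_empty, Nat.cast_zero]
    by_cases hvB : (v : α) ∈ B
    · obtain ⟨f, hf, _, hfL⟩ := hBG v hvB
      rw [hfL]
      exact natCast_eq_zero_of_encard_eq_two (encard_ne_eq_two hf k)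
    by_cases hv : (v : α) ∈ V(L)
    · obtain ⟨h2, hcol, _⟩ := hB2 v hv hvB
      by_cases hk : φ.vertexColor v = k
      · exact hempty (Set.eq_empty_of_forall_notMem fun e he ↦ he.2 ((hcol e he.1).trans hk))
      · have : {e | e ∈ L.incidenceSet (v : α) ∧ φ.edgeColor e ≠ k} = L.incidenceSet (v : α) :=
          Set.Subset.antisymm (fun e he ↦ he.1) fun e he ↦ ⟨he, by rwa [hcol e he]⟩
        rw [this]
        exact natCast_eq_zero_of_encard_eq_two h2
    · exact hempty (Set.eq_empty_of_forall_notMem fun e he ↦ hv (Graph.Inc.vertex_mem he.1))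
  · intro x y hx hy hxk hyk hxf hyf
    rw [hκ] at hx hy
    -- An end of an edge outside the frame is thus no branch vertex. This matters because a perfect
    -- coloring controls the colors of 2-valent vertices only.
    have hfree : ∀ z : V(G), (∃ e : E(G), ¬ (e : β) ∈ E(F) ∧ (s e = z ∨ t e = z)) →
        (z : α) ∉ B := by
      rintro z ⟨e, heF, hez⟩ hzB
      obtain ⟨f, _, hfG, hfL⟩ := hBG z hzB
      have hinc : (e : β) ∈ G.incidenceSet (z : α) := by
        rcases hez with rfl | rfl
        exacts [(hst e).inc_left, (hst e).inc_right]
      rw [hfG, ← hfL] at hinc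
      exact heF (hL.edgeSet_mono (Graph.Inc.edge_mem hinc))
    obtain ⟨z, hz, hzx⟩ := (hB2 x hx (hfree x hxf)).2.2 k hxk
    obtain ⟨w, hw, hwy⟩ := (hB2 y hy (hfree y hyf)).2.2 k hyk
    refine reach_joins hst (Graph.restrict_le.trans hLG) (fun e he ↦ (hcp e).2 ?_)
      ((reach_symm hzx).trans ((hBc k z hz w hw).trans hwy))
    exact ⟨Graph.restrict_le.edgeSet_mono he, he.2⟩

end Translation

end CDC

/-! ### Application to a well connected Kotzig-frame. -/

theorem theorem1 {α : Type*} {β : Type*} (G : Graph α β) (hfin : CDC.IsFinite G)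
    (hloop : G.Loopless) (hcubic : CDC.IsCubic G)
    (hframe : ∃ F : Graph α β, CDC.IsKotzigFrame G F ∧ CDC.IsWellConnected G F) :
    CDC.HasCycleDoubleCover 6 G := by
  open CDC in
  classical
  obtain ⟨F, hF, φ, hφ, H, hHle, hHconn, hHK, a, hHa⟩ := hframe
  have hFG : F ≤ G := hF.spanning.le
  have hVF : V(F) = V(G) := hF.spanning.vertexSet_eq
  have hVx (v : V(G)) : (v : α) ∈ V(F) := by
    rw [hVF]
    exact v.2
  have := hfin.1.to_subtype
  have := hfin.2.to_subtype
  have := Fintype.ofFinite V(G)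
  have := Fintype.ofFinite E(G)
  have hends : ∀ e : E(G), ∃ x y : V(G), G.IsLink (e : _) (x : _) (y : _) := by
    rintro ⟨e, he⟩
    obtain ⟨x, y, h⟩ := G.exists_isLink_of_mem_edgeSet he
    exact ⟨⟨x, h.left_mem⟩, ⟨y, h.right_mem⟩, h⟩
  choose s t hst using hends
  set comp : V(G) → Graph α β := fun v ↦ componentAt F v with hcomp_def
  have := Fintype.ofFinite (Set.range comp)
  set κ : V(G) → Set.range comp := fun v ↦ ⟨comp v, v, rfl⟩ with hκ_def
  have hκeq (v w : V(G)) : κ v = κ w ↔ (v : α) ∈ V(componentAt F (w : α)) := by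
    simp only [hκ_def, hcomp_def, Subtype.mk.injEq]
    constructor
    · intro h
      rw [← h]
      exact self_mem_componentAt (hVx v)
    · intro h
      exact (componentAt_eq_of_reach h.2).symm
  have hFst (e : E(G)) (he : (e : β) ∈ E(F)) : F.IsLink (e : β) (s e : α) (t e : α) :=
    (hFG.isLink_iff he).2 (hst e)
  have hFκ (e : E(G)) (he : (e : β) ∈ E(F)) : κ (s e) = κ (t e) :=
    Subtype.ext (componentAt_eq_of_reach (.single ⟨e, hFst e he⟩))
  have hEL (x : V(G)) (e : E(G)) :
      (e : β) ∈ E(F) ∧ κ (s e) = κ x ↔ (e : β) ∈ E(componentAt F (x : α)) := by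
    rw [hκeq]
    constructor
    · rintro ⟨he, hs⟩
      exact (componentAt_isLink.2 ⟨hFst e he, hs.2⟩).edge_mem
    · intro he
      have heF := componentAt_le.edgeSet_mono he
      exact ⟨heF, ((componentAt_le.isLink_iff he).2 (hFst e heF)).left_mem⟩
  have hcompat (e : β) (L L' : Graph α β) (h : H.IsLink e L L') : ∃ he : e ∈ E(G),
      e ∉ E(F) ∧ (((κ (s ⟨e, he⟩) : Graph α β) = L ∧ (κ (t ⟨e, he⟩) : Graph α β) = L') ∨
        ((κ (s ⟨e, he⟩) : Graph α β) = L' ∧ (κ (t ⟨e, he⟩) : Graph α β) = L)) := by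
    obtain ⟨x, y, hxy, rfl, rfl, hne⟩ := contraction_isLink (h.mono hHle)
    refine ⟨hxy.edge_mem, fun heF ↦ hne ?_, ?_⟩
    · exact componentAt_eq_of_reach (.single ⟨e, (hFG.isLink_iff heF).2 hxy⟩)
    · rcases (hst ⟨e, hxy.edge_mem⟩).eq_and_eq_or_eq_and_eq hxy with ⟨h1, h2⟩ | ⟨h1, h2⟩
      · exact .inl ⟨by simp only [hκ_def, hcomp_def, h1], by simp only [hκ_def, hcomp_def, h2]⟩
      · exact .inr ⟨by simp only [hκ_def, hcomp_def, h1], by simp only [hκ_def, hcomp_def, h2]⟩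
  have hone : (fun _ ↦ 1 : V(G) → ZMod 2) = boundary s t (fun e ↦ indic ((e : β) ∈ E(G))) := by
    funext v
    rw [boundary_indic_eq_ncard hloop hst]
    have h1 : {e | e ∈ E(G) ∧ G.Inc e (v : α)} = G.incidenceSet (v : α) :=
      Set.Subset.antisymm (fun e he ↦ he.2) fun e he ↦ ⟨Graph.Inc.edge_mem he, he⟩
    rw [h1, Set.ncard_def, ← degree_eq_of_loopless hloop, hcubic v v.2]
    rfl
  -- Frame edges become loops. The boundary of all edges is 1 at every vertex, as 3 is odd, so at a
  -- component it counts the vertices mod 2; here the even orders of the components enter.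
  have hpar : boundary (κ ∘ s) (κ ∘ t) (fun e ↦ indic (¬ (e : β) ∈ E(F))) = 0 := by
    have h1 : boundary (κ ∘ s) (κ ∘ t) (fun e ↦ indic ((e : β) ∈ E(F))) = 0 := by
      funext q
      refine Finset.sum_eq_zero fun e _ ↦ ?_
      by_cases he : (e : β) ∈ E(F)
      · simp only [Function.comp, hFκ e he, add_self_zmod2, mul_zero]
      · change indic _ * _ = 0
        rw [indic_neg he, zero_mul]
    have h2 : boundary (κ ∘ s) (κ ∘ t) (fun e ↦ indic ((e : β) ∈ E(G))) = 0 := by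
      funext q
      obtain ⟨_, x, rfl⟩ := q
      have hfib (v : V(G)) : indic (κ v = ⟨comp x, x, rfl⟩) * (1 : ZMod 2) =
          if (v : α) ∈ V(componentAt F (x : α)) then 1 else 0 := by
        rw [mul_one]
        exact congrArg indic (propext (hκeq v x))
      rw [boundary_comp, ← hone]
      simp_rw [hfib]
      rw [Finset.sum_boole, Pi.zero_apply]
      have h3 : V(componentAt F (x : α)).ncard =
          (Finset.univ.filter fun v : V(G) ↦ (v : α) ∈ V(componentAt F (x : α))).card := by
        rw [← Set.ncard_coe_finset, ← Set.ncard_image_of_injective _ Subtype.val_injective]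
        congr 1
        ext y
        simp only [Finset.coe_filter, Finset.mem_univ, true_and, Set.mem_image,
          Set.mem_ofPred_eq, Subtype.exists, exists_and_right, exists_eq_right]
        exact ⟨fun h ↦ ⟨hFG.vertexSet_mono h.1, h⟩, fun ⟨_, h⟩ ↦ h⟩
      rw [← h3, ZMod.natCast_eq_zero_iff, ← even_iff_two_dvd]
      exact hF.even_card _ ⟨x, hVx x, rfl⟩
    have h3 : (fun e : E(G) ↦ indic (¬ (e : β) ∈ E(F))) =
        (fun e : E(G) ↦ indic ((e : β) ∈ E(G))) + fun e : E(G) ↦ indic ((e : β) ∈ E(F)) := by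
      funext e
      have h11 : (1 : ZMod 2) + 1 = 0 := by decide
      by_cases he : (e : β) ∈ E(F) <;> simp [indic, he, h11]
    rw [h3, boundary_add, h1, h2, add_zero]
  obtain ⟨A, hA0, hA2⟩ := exists_even_double_cover (s := s) (t := t) (κ := κ)
    (inF := fun e ↦ (e : β) ∈ E(F)) (col := fun v ↦ φ.vertexColor v)
    (ecol := fun e ↦ φ.edgeColor e) a hpar (fun q ↦ (q : Graph α β) ∈ V(H))
    (fun e ↦ (e : β) ∈ E(H))
    (by
      rintro ⟨_, x, rfl⟩
      have hxF : (x : α) ∈ V(F) := hVx x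
      have hcomp : IsComponent F (componentAt F (x : α)) := ⟨x, hxF, rfl⟩
      have hLG : componentAt F (x : α) ≤ G := componentAt_le.trans hFG
      -- For a cycle only evenness and connectedness are supplied, since its color may be replaced;
      -- a K-component lies in `H` and keeps its perfect coloring up to exchanging the two colors
      -- other than `a`.
      by_cases hcyc : IsCycle (componentAt F (x : α))
      · right
        have hEx : ∀ e : E(G), ((e : β) ∈ E(F) ∧ κ (s e) = ⟨comp x, x, rfl⟩) ↔
            (e : β) ∈ E(componentAt F (x : α)) := hEL x
        constructor
        · funext v
          simp_rw [hEx]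
          rw [boundary_indic_eq_ncard hloop hst, Pi.zero_apply]
          have hset : {e | e ∈ E(componentAt F (x : α)) ∧ G.Inc e (v : α)} =
              (componentAt F (x : α)).incidenceSet (v : α) := by
            ext e
            exact ⟨fun h ↦ (hLG.inc_congr h.1).2 h.2,
              fun h ↦ ⟨Graph.Inc.edge_mem h, Graph.Inc.mono hLG h⟩⟩
          rw [hset]
          by_cases hv : (v : α) ∈ V(componentAt F (x : α))
          · apply natCast_eq_zero_of_encard_eq_two
            rw [← degree_eq_of_loopless (hloop.anti hLG), hcyc.degree_eq v hv]
          · have : (componentAt F (x : α)).incidenceSet (v : α) = ∅ :=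
              Set.eq_empty_of_forall_notMem fun e he ↦ hv (Graph.Inc.vertex_mem he)
            rw [this, Set.ncard_empty, Nat.cast_zero]
        · intro y z hy hz
          exact reach_joins hst hLG (fun e he ↦ (hEx e).2 he)
            (hcyc.connected.2 y ((hκeq y x).1 hy) z ((hκeq z x).1 hz))
      · exact .inl ⟨hHK _ ⟨hcomp, hcyc⟩, goodAt_of_isPerfectOnSubdivision hloop hcubic hst hFG
          componentAt_le (fun v ↦ hκeq v x) (hEL x) (hφ.1 _ ⟨hcomp, hcyc⟩)⟩)
    (by
      intro e he
      obtain ⟨L, L', hl⟩ := H.exists_isLink_of_mem_edgeSet he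
      obtain ⟨_, heF, hκL⟩ := hcompat e L L' hl
      obtain ⟨_, x, y, hxy, hx, hy⟩ := hHa e he
      have hcol : φ.vertexColor (s e) = a ∧ φ.vertexColor (t e) = a := by
        rcases (hst e).eq_and_eq_or_eq_and_eq hxy with ⟨h1, h2⟩ | ⟨h1, h2⟩
        · rw [h1, h2]; exact ⟨hx, hy⟩
        · rw [h1, h2]; exact ⟨hy, hx⟩
      have hmem : (κ (s e) : Graph α β) ∈ V(H) ∧ (κ (t e) : Graph α β) ∈ V(H) := by
        rcases hκL with ⟨h1, h2⟩ | ⟨h1, h2⟩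
        · exact ⟨h1 ▸ hl.left_mem, h2 ▸ hl.right_mem⟩
        · exact ⟨h1 ▸ hl.right_mem, h2 ▸ hl.left_mem⟩
      exact ⟨heF, ⟨hmem.1, hcol.1⟩, hmem.2, hcol.2⟩)
    (by
      rintro ⟨q, hq⟩ ⟨r, hr⟩ hqH hrH
      have hreach := hHconn.2 q hqH r hrH
      dsimp only at hqH
      clear hrH
      induction hreach with
      | refl => exact .refl
      | @tail L L' _ hLL ih =>
        obtain ⟨e, he⟩ := hLL
        obtain ⟨heG, _, hκL⟩ := hcompat e L L' he
        have hL : L ∈ Set.range comp := by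
          rcases hκL with ⟨h1, _⟩ | ⟨_, h1⟩
          · exact h1 ▸ (κ (s ⟨e, heG⟩)).2
          · exact h1 ▸ (κ (t ⟨e, heG⟩)).2
        refine (ih hL).tail ⟨⟨e, heG⟩, he.edge_mem, ?_⟩
        rcases hκL with ⟨h1, h2⟩ | ⟨h1, h2⟩
        · exact .inl ⟨Subtype.ext h1, Subtype.ext h2⟩
        · exact .inr ⟨Subtype.ext h1, Subtype.ext h2⟩)
  have hmem (i : Fin 3 ⊕ Fin 3) (e : E(G)) :
      (e : β) ∈ {e | ∃ he : e ∈ E(G), A i ⟨e, he⟩ ≠ 0} ↔ A i e ≠ 0 :=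
    ⟨fun ⟨_, h⟩ ↦ h, fun h ↦ ⟨e.2, h⟩⟩
  refine hasCycleDoubleCover_of_even hfin hloop hcubic
    (fun i : Fin (3 + 3) ↦ {e | ∃ he : e ∈ E(G), A (finSumFinEquiv.symm i) ⟨e, he⟩ ≠ 0}) ?_ ?_
  · intro i x hx
    have h := congrFun (hA0 (finSumFinEquiv.symm i)) ⟨x, hx⟩
    have hind : A (finSumFinEquiv.symm i) = fun e : E(G) ↦
        indic ((e : β) ∈ {e | ∃ he : e ∈ E(G), A (finSumFinEquiv.symm i) ⟨e, he⟩ ≠ 0}) := by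
      funext e
      rw [hmem]
      by_cases he : A (finSumFinEquiv.symm i) e = 0
      · rw [indic_neg (not_not.2 he), he]
      · rw [indic_pos he, eq_one_of_ne_zero he]
    rw [hind, boundary_indic_eq_ncard hloop hst, Pi.zero_apply, ZMod.natCast_eq_zero_iff,
      ← even_iff_two_dvd] at h
    exact h
  · intro e he
    obtain ⟨i, j, hij, h⟩ := hA2 ⟨e, he⟩
    refine ⟨finSumFinEquiv i, finSumFinEquiv j, fun h ↦ hij (finSumFinEquiv.injective h), ?_⟩
    intro l
    rw [hmem _ ⟨e, he⟩, h, Equiv.symm_apply_eq, Equiv.symm_apply_eq]
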